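/- A ribbon graph (map) with $e\ge 1$ edges is a pair of permutations $(\alpha,\sigma)$ of $H=\{1,\dots,2e\}$ such that $\alpha$ is a fixed point free involution and $\langle\alpha,\sigma\rangle$ acts transitively on $H$. For $N\ge 1$, an $N$-rooted map is a ribbon graph with an ordered choice of $N$ elements of $H$ lying in $N$ distinct cycles of $\sigma$ (fixed points count as cycles). An isomorphism is a permutation of $H$ that intertwines the two pairs $(\alpha,\sigma)$ and maps the $i$-th root to the $i$-th root for every $i$. Let $m_N(e)$ be the number of isomorphism classes of $N$-rooted maps with $e$ edges; for $e=0$ the only graph is a single point, which counts as one-rooted, so $m_1(0)=1$ and $m_N(0)=0$ for $N\ge 2$. Consider the formal series $$M_N(\lambda)=\sum_{e\ge 0} m_N(e)\lambda^{2e}\quad(N\ge1),\qquad \mathcal Z_j(\lambda)=\sum_{k\ge 0}\frac{(2k+j)!\,(2k-1)!!}{(2k)!}\lambda^{2k}\quad (j\ge 0,\ (-1)!!=1).$$ Define numbers $B_{n,2k-1}$ for $n\ge 0$, $k\ge 0$ by $B_{0,-1}=1$, $B_{0,2k-1}=0$ for $k\ge1$, and $$B_{n+1,2k-1}=B_{n,2k-3}+(2k+n+1)B_{n,2k-1}\qquad(n\ge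 0,\ k\ge 0),\qquad B_{n,-3}=0.$$ In particular $B_{1,-1}=B_{1,1}=1$ and $B_{n,2n+1}=0$. Let $H(i)=1$ for $i\ge 0$ and $H(i)=0$ for $i<0$, and for $j\ge 0$ let $P_j(X)$ be the polynomial in $X$ of degree at most one, with Laurent polynomials in $\lambda$ as coefficients, given by $$P_j(X)=\sum_{n=0}^{j}\binom jn\frac{j!}{n!}\sum_{k=0}^{n}(-1)^{n-k}B_{n,2k-1}\Bigl[\delta_{k,0}+H(k-1)\frac{X}{\lambda^{2k-2}}-H(k-2)\,(1-\lambda^2X)\sum_{m=0}^{k-2}\frac{(2m+1)!!}{\lambda^{2k-2m-2}}\Bigr].$$ For $N\ge1$ and $r_1,\dots,r_N$ in a commutative $\mathbb Q$-algebra put $$F_N(r_1,\dots,r_N)=\sum_{\alpha_1+2\alpha_2+\cdots+N\alpha_N=N}\frac{N!}{\alpha_1!\cdots\alpha_N!}\,(-1)^{\alpha_1+\cdots+\alpha_N-1}(\alpha_1+\cdots+\alpha_N-1)!\prod_{j=1}^N\Bigl(\frac{r_j}{(j!)^2}\Bigr)^{\alpha_j},$$ the sum being over integers $\alpha_1,\dots,\alpha_N\ge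 0$. **Theorem 3.** The following identities of formal Laurent series in $\lambda$ over $\mathbb Q$ hold. 1. $\mathcal Z_0-1=\lambda^2M_1\mathcal Z_0$ and $1/\mathcal Z_0=1-\lambda^2M_1$. 2. For every $j\ge 0$, $\mathcal Z_j/\mathcal Z_0=P_j(M_1)$. 3. For every $N\ge 1$, $M_N=F_N(\mathcal Z_1/\mathcal Z_0,\dots,\mathcal Z_N/\mathcal Z_0)$. Substituting the expressions of part 2 gives $M_N=Q_N(M_1)$, where $Q_N=F_N(P_1,\dots,P_N)$ is a polynomial in $X$ with Laurent polynomials in $\lambda$ as coefficients, of degree exactly $N$. -/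

import Mathlib

open LaurentSeries

noncomputable section

/-- A ribbon graph with `e` edges on the half-edges `Fin (2 * e)`: a fixed point free involution
`α`, whose orbits are the edges, and a permutation `σ`, whose cycles (fixed points included) are
the vertices, such that `⟨α, σ⟩` acts transitively on the half-edges. -/
structure RibbonGraph (e : ℕ) where
  α : Equiv.Perm (Fin (2 * e))
  σ : Equiv.Perm (Fin (2 * e))
  involutive : ∀ h, α (α h) = h
  fixedPointFree : ∀ h, α h ≠ h
  transitive :
    MulAction.IsPretransitive (Subgroup.closure ({α, σ} : Set (Equiv.Perm (Fin (2 * e)))))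
      (Fin (2 * e))

/-- An `N`-rooted ribbon graph with `e` edges: a ribbon graph with an ordered choice of `N` root
half-edges that lie on pairwise distinct vertices (cycles of `σ`). -/
structure NRootedGraph (N e : ℕ) extends RibbonGraph e where
  root : Fin N → Fin (2 * e)
  distinctVertices : ∀ i j, i ≠ j → ¬ σ.SameCycle (root i) (root j)

/-- `N`-rooted isomorphism: a relabelling of the half-edges that intertwines the two pairs of
permutations and maps the `k`-th root to the `k`-th root. -/
def NRootedGraph.Iso {N e : ℕ} (G G' : NRootedGraph N e) : Prop :=
  ∃ ψ : Equiv.Perm (Fin (2 * e)),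
    (∀ h, G'.α (ψ h) = ψ (G.α h)) ∧ (∀ h, G'.σ (ψ h) = ψ (G.σ h)) ∧
      ∀ k, ψ (G.root k) = G'.root k

/-- Isomorphism is an equivalence relation. -/
instance NRootedGraph.isoSetoid (N e : ℕ) : Setoid (NRootedGraph N e) where
  r := NRootedGraph.Iso
  iseqv :=
    { refl := fun _ => ⟨1, fun _ => rfl, fun _ => rfl, fun _ => rfl⟩
      symm := by
        rintro G G' ⟨ψ, hα, hσ, hr⟩
        refine ⟨ψ⁻¹, fun h => ?_, fun h => ?_, fun k => ?_⟩
        · apply ψ.injective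
          rw [← hα]; simp
        · apply ψ.injective
          rw [← hσ]; simp
        · rw [← hr]; simp
      trans := by
        rintro G G' G'' ⟨ψ, hα, hσ, hr⟩ ⟨ψ', hα', hσ', hr'⟩
        refine ⟨ψ' * ψ, fun h => ?_, fun h => ?_, fun k => ?_⟩
        · simp [hα, hα']
        · simp [hσ, hσ']
        · simp [hr, hr'] }

/-- `m_N(e)` for `N ≥ 1`: the number of `N`-rooted ribbon graphs with `e` edges, of any genus, up
to isomorphism. The only graph without half-edges is a single point, which counts as a one-rooted
graph. -/
def numRooted (N e : ℕ) : ℕ :=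
  if e = 0 then (if N = 1 then 1 else 0) else Nat.card (Quotient (NRootedGraph.isoSetoid N e))

/-- The formal generating function `M_N(λ) = ∑ₑ m_N(e) λ^{2e}`. -/
def genM (N : ℕ) : PowerSeries ℚ :=
  PowerSeries.mk fun i => if Even i then (numRooted N (i / 2) : ℚ) else 0

/-- The formal series `𝒵_j(λ) = ∑ₖ (2k+j)! (2k-1)!! / (2k)! λ^{2k}`, where `(-1)!! = 1`. -/
def serZ (j : ℕ) : PowerSeries ℚ :=
  PowerSeries.mk fun i =>
    if Even i then
      ((i + j).factorial : ℚ) * ((i - 1).doubleFactorial : ℚ) / (i.factorial : ℚ)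
    else 0

/-- `coeffB n k` is the coefficient `B_{n,2k-1}`. -/
def coeffB : ℕ → ℕ → ℕ
  | 0, 0 => 1
  | 0, _ + 1 => 0
  | n + 1, 0 => (n + 1) * coeffB n 0
  | n + 1, k + 1 => coeffB n k + (2 * (k + 1) + n + 1) * coeffB n (k + 1)

/-- The boundary values `B_{n,2k-1} = 0` for `k > n`; in particular `B_{n,2n+1} = 0`. -/
theorem coeffB_eq_zero : ∀ n k : ℕ, n < k → coeffB n k = 0
  | 0, _ + 1, _ => rfl
  | n + 1, k + 1, h => by
    rw [coeffB, coeffB_eq_zero n k (by omega), coeffB_eq_zero n (k + 1) (by omega), mul_zero, add_zero]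

/-- The remaining initial values `B_{0,-1} = B_{1,-1} = B_{1,1} = 1`. -/
theorem coeffB_initial : coeffB 0 0 = 1 ∧ coeffB 1 0 = 1 ∧ coeffB 1 1 = 1 := by
  simp [coeffB]

/-- The expression for `𝒵_j / 𝒵_0`, as a polynomial in one indeterminate `X` (standing for `M_1`)
whose coefficients are Laurent polynomials in `λ`; `LaurentPolynomial.T i` is `λ^i`. -/
def ratioPoly (j : ℕ) : Polynomial (LaurentPolynomial ℚ) :=
  ∑ n ∈ Finset.range (j + 1), ∑ k ∈ Finset.range (n + 1),
    Polynomial.C (LaurentPolynomial.C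
      ((j.choose n : ℚ) * ((j.factorial : ℚ) / (n.factorial : ℚ)) *
        ((-1) ^ (n - k) * (coeffB n k : ℚ)))) *
      ((if k = 0 then 1 else 0)
        + (if 1 ≤ k then
            Polynomial.C (LaurentPolynomial.T (-(2 * (k : ℤ) - 2))) * Polynomial.X
          else 0)
        - (if 2 ≤ k then
            (1 - Polynomial.C (LaurentPolynomial.T 2) * Polynomial.X) *
              ∑ m ∈ Finset.range (k - 1),
                Polynomial.C (LaurentPolynomial.C ((2 * m + 1).doubleFactorial : ℚ) *
                  LaurentPolynomial.T (-(2 * (k : ℤ) - 2 * (m : ℤ) - 2)))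
          else 0))

/-- The tuples `(α_1, …, α_N)` of natural numbers with `α_1 + 2 α_2 + ⋯ + N α_N = N`; the entry
`α_j` is `a (j - 1)`. The bound `α_j ≤ N` is automatic and only makes the set visibly finite. -/
def weightTuples (N : ℕ) : Finset (Fin N → ℕ) :=
  (Fintype.piFinset fun _ : Fin N => Finset.range (N + 1)).filter
    fun a => ∑ j : Fin N, ((j : ℕ) + 1) * a j = N

/-- The sum
`∑ N! / (α_1! ⋯ α_N!) (-1)^{α_1+⋯+α_N-1} (α_1+⋯+α_N-1)! ∏_j (r_j / (j!)²)^{α_j}`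
over all `α` with `α_1 + 2 α_2 + ⋯ + N α_N = N`, as a function of `r_1, …, r_N`
(with `r_j = 𝒵_j / 𝒵_0` for the generating functions). -/
def connectedSum {R : Type*} [CommRing R] [Algebra ℚ R] (N : ℕ) (r : ℕ → R) : R :=
  ∑ a ∈ weightTuples N,
    algebraMap ℚ R
      ((N.factorial : ℚ) / (∏ j : Fin N, ((a j).factorial : ℚ)) *
        ((-1) ^ ((∑ j : Fin N, a j) - 1) * (((∑ j : Fin N, a j) - 1).factorial : ℚ))) *
      ∏ j : Fin N,
        (algebraMap ℚ R (1 / (((j : ℕ) + 1).factorial : ℚ) ^ 2) * r ((j : ℕ) + 1)) ^ a j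

/-- The variable `λ` as a unit of the field of formal Laurent series. -/
def lamUnit : (ℚ⸨X⸩)ˣ :=
  Units.mk0 (HahnSeries.single (1 : ℤ) (1 : ℚ)) (by simp)

/-- A Laurent polynomial in `λ`, read as a formal Laurent series in `λ`. -/
def toSeries : LaurentPolynomial ℚ →+* ℚ⸨X⸩ :=
  LaurentPolynomial.eval₂ (HahnSeries.C : ℚ →+* ℚ⸨X⸩) lamUnit

/-- The value at `M_1(λ)` of a polynomial with Laurent polynomial coefficients in `λ`. -/
def evalAtM1 (P : Polynomial (LaurentPolynomial ℚ)) : ℚ⸨X⸩ :=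
  P.eval₂ toSeries (genM 1 : ℚ⸨X⸩)

end

/-!
Put a mark into the cycle of `σ` in front of every root: an `N`-rooted map becomes a pair of
permutations of half-edges and marks, the first of which fixes exactly the marks, with the marks on
distinct cycles of the second and the whole configuration connected. Without connectedness there are
`(n - 1)!! (n + N)! / N!` such pairs on `n` half-edges and `N` marks, which are the coefficients of
`𝒵_N`. Splitting off the connected component of one mark shows that `∑ M_{n+1} tⁿ / n!` is the
logarithmic derivative of `∑ (𝒵_j / 𝒵_0) tʲ / (j!)²`, and `F_N` is `N!` times the coefficient of
`tᴺ` in the logarithm of that series. The ratios `𝒵_j / 𝒵_0` are linear in `M_1` because `𝒵_j` is a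
linear combination of the series `D_k = ∑ₘ (2m+2k-1)!! λ^{2m}`: one has `D_0 = 𝒵_0`,
`D_1 = M_1 𝒵_0` and `D_k = (2k-1)!! + λ² D_{k+1}`.
-/

section PermutationPairs

open Equiv

variable {X Y : Type*}

/-- A pair `(α, σ)` of permutations, seen as a graph whose edges are the cycles of `α` and whose
vertices are the cycles of `σ`; neither connectedness nor a condition on `α` is imposed. -/
abbrev PermPair (X : Type*) := Perm X × Perm X

namespace PermPair

/-- The connected component of `x`: its orbit under the group generated by the pair. -/
def component (p : PermPair X) (x : X) : Set X :=
  MulAction.orbit (Subgroup.closure {p.1, p.2}) x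

/-- Sets stable under both permutations, that is, unions of components. Components of different
pairs are compared through their invariant sets. -/
def IsInvariant (p : PermPair X) (s : Set X) : Prop :=
  (∀ x, p.1 x ∈ s ↔ x ∈ s) ∧ ∀ x, p.2 x ∈ s ↔ x ∈ s

/-- Connectedness of the underlying graph: the pair generates a transitive group. -/
def IsConnected (p : PermPair X) : Prop :=
  MulAction.IsPretransitive (Subgroup.closure {p.1, p.2}) X

theorem IsInvariant.compl {p : PermPair X} {s : Set X} (h : p.IsInvariant s) :
    p.IsInvariant sᶜ :=
  ⟨fun x => not_congr (h.1 x), fun x => not_congr (h.2 x)⟩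

theorem self_mem_component (p : PermPair X) (x : X) : x ∈ p.component x :=
  MulAction.mem_orbit_self x

theorem isInvariant_component (p : PermPair X) (x : X) : p.IsInvariant (p.component x) := by
  have apply_mem (g : Perm X) (hg : g ∈ ({p.1, p.2} : Set (Perm X))) (y : X) :
      g y ∈ p.component x ↔ y ∈ p.component x := by
    have hy := MulAction.orbit_smul (⟨g, Subgroup.subset_closure hg⟩ : Subgroup.closure _) y
    rw [component, ← MulAction.orbit_eq_iff, ← MulAction.orbit_eq_iff]
    exact Eq.congr_left hy
  exact ⟨apply_mem p.1 (by simp), apply_mem p.2 (by simp)⟩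

theorem IsInvariant.component_subset {p : PermPair X} {s : Set X} (hs : p.IsInvariant s) {x : X}
    (hx : x ∈ s) : p.component x ⊆ s := by
  rintro _ ⟨⟨g, hg⟩, rfl⟩
  suffices ∀ y, g y ∈ s ↔ y ∈ s from (this x).2 hx
  induction hg using Subgroup.closure_induction with
  | mem g hg =>
    rcases hg with rfl | rfl
    exacts [hs.1, hs.2]
  | one => exact fun _ => Iff.rfl
  | mul g h _ _ hg hh => exact fun y => (hg _).trans (hh y)
  | inv g _ hg => exact fun y => by simpa using (hg (g.symm y)).symm

theorem isConnected_iff_component_eq_univ {p : PermPair X} (x : X) :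
    p.IsConnected ↔ p.component x = Set.univ :=
  MulAction.isPretransitive_iff_orbit_eq_univ x

theorem IsConnected.eq_univ {p : PermPair X} (hp : p.IsConnected) {s : Set X}
    (hs : p.IsInvariant s) {x : X} (hx : x ∈ s) : s = Set.univ :=
  Set.eq_univ_of_univ_subset
    ((isConnected_iff_component_eq_univ x).1 hp ▸ hs.component_subset hx)

theorem mem_component_one_iff {σ : Perm X} {x y : X} :
    y ∈ component (1, σ) x ↔ σ.SameCycle x y := by
  rw [component, Subgroup.closure_insert_one, ← Subgroup.zpowers_eq_closure]
  exact Subgroup.exists_zpowers (p := fun g : Subgroup.zpowers σ => g.1 x = y)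

theorem apply_mem_component_iff {p : PermPair X} {q : PermPair Y} (f : X → Y)
    (h : ∀ s, p.IsInvariant s ↔ ∃ t, q.IsInvariant t ∧ f ⁻¹' t = s) {x y : X} :
    f y ∈ q.component (f x) ↔ y ∈ p.component x := by
  constructor
  · intro hy
    obtain ⟨t, ht, hts⟩ := (h _).1 (p.isInvariant_component x)
    rw [← hts]
    exact ht.component_subset (hts.ge (p.self_mem_component x)) hy
  · have hinv := (h _).2 ⟨_, q.isInvariant_component (f x), rfl⟩
    exact fun hy => hinv.component_subset (q.self_mem_component (f x)) hy

theorem apply_mem_component_iff_of_injective {p : PermPair X} {q : PermPair Y} {f : X → Y}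
    (hf : Function.Injective f) (h₁ : ∀ x, q.1 (f x) = f (p.1 x))
    (h₂ : ∀ x, q.2 (f x) = f (p.2 x)) {x y : X} :
    f y ∈ q.component (f x) ↔ y ∈ p.component x := by
  have mem_image_iff {g : Perm X} {g' : Perm Y} (hg : ∀ x, g' (f x) = f (g x)) {s : Set X}
      (hs : ∀ x, g x ∈ s ↔ x ∈ s) (y : Y) : g' y ∈ f '' s ↔ y ∈ f '' s := by
    constructor
    · rintro ⟨z, hz, hzy⟩
      exact ⟨g.symm z, by rwa [← hs, g.apply_symm_apply],
        g'.injective (by rw [hg, g.apply_symm_apply, hzy])⟩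
    · rintro ⟨z, hz, rfl⟩
      exact ⟨g z, (hs z).2 hz, (hg z).symm⟩
  refine apply_mem_component_iff f fun s => ⟨fun hs => ?_, ?_⟩
  · exact ⟨f '' s, ⟨mem_image_iff h₁ hs.1, mem_image_iff h₂ hs.2⟩, hf.preimage_image s⟩
  · rintro ⟨t, ht, rfl⟩
    exact ⟨fun x => by simp [← h₁, ht.1], fun x => by simp [← h₂, ht.2]⟩

theorem isConnected_iff_forall_mem_component {p : PermPair X} :
    p.IsConnected ↔ ∀ x y, y ∈ p.component x :=
  MulAction.isPretransitive_iff _ _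

theorem isConnected_iff_of_surjective {p : PermPair X} {q : PermPair Y} {f : X → Y}
    (hf : Function.Surjective f) (h : ∀ x y, f y ∈ q.component (f x) ↔ y ∈ p.component x) :
    q.IsConnected ↔ p.IsConnected := by
  simp only [isConnected_iff_forall_mem_component, hf.forall, h]

theorem isConnected_permCongr (e : X ≃ Y) (p : PermPair X) :
    IsConnected (e.permCongr p.1, e.permCongr p.2) ↔ p.IsConnected := by
  refine isConnected_iff_of_surjective e.surjective fun x y =>
    apply_mem_component_iff_of_injective e.injective ?_ ?_
  all_goals exact fun z => by simp

end PermPair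

theorem sameCycle_apply_iff_of_injective {σ : Perm X} {τ : Perm Y} {f : X → Y}
    (hf : Function.Injective f) (h : ∀ x, τ (f x) = f (σ x)) {x y : X} :
    τ.SameCycle (f x) (f y) ↔ σ.SameCycle x y := by
  rw [← PermPair.mem_component_one_iff, ← PermPair.mem_component_one_iff]
  exact PermPair.apply_mem_component_iff_of_injective hf (fun _ => rfl) h

theorem sameCycle_removeNone (τ : Perm (Option X)) (x y : X) :
    Perm.SameCycle (removeNone τ) x y ↔ τ.SameCycle (some x) (some y) := by
  rw [← PermPair.mem_component_one_iff, ← PermPair.mem_component_one_iff, iff_comm]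
  refine PermPair.apply_mem_component_iff some fun s => ⟨fun hs => ?_, ?_⟩
  · refine ⟨{o | o.elim (∃ x ∈ s, τ none = some x) (· ∈ s)}, ⟨fun _ => Iff.rfl, ?_⟩, rfl⟩
    rintro (_ | x)
    · cases τ none <;> simp
    · have hx := hs.2 x
      rcases h : τ (some x) with _ | w
      · simpa [← removeNone_none τ h] using hx
      · have hw := removeNone_some τ ⟨w, h⟩
        simp_all
  · rintro ⟨t, ht, rfl⟩
    refine ⟨fun _ => Iff.rfl, fun x => ?_⟩
    rcases h : τ (some x) with _ | w
    · simp only [Set.mem_preimage, removeNone_none τ h]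
      rw [ht.2, ← h, ht.2]
    · simp only [Set.mem_preimage, removeNone_some τ ⟨w, h⟩]
      exact ht.2 _

/-- Distinct points of `S` lie on distinct cycles of `τ`. -/
def SeparatesCycles (S : Set X) (τ : Perm X) : Prop :=
  ∀ ⦃x⦄, x ∈ S → ∀ ⦃y⦄, y ∈ S → τ.SameCycle x y → x = y

/-- `α` is a perfect matching of the complement of `S`: an involution with fixed point set `S`. -/
def IsMatchingOff (S : Set X) (α : Perm X) : Prop :=
  Function.Involutive α ∧ ∀ x, α x = x ↔ x ∈ S

theorem separatesCycles_permCongr (e : X ≃ Y) (S : Set Y) (τ : Perm X) :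
    SeparatesCycles S (e.permCongr τ) ↔ SeparatesCycles (e ⁻¹' S) τ := by
  have hcycle (x y : X) : (e.permCongr τ).SameCycle (e x) (e y) ↔ τ.SameCycle x y :=
    sameCycle_apply_iff_of_injective e.injective fun x => by simp
  simp [SeparatesCycles, ← e.forall_congr_right, hcycle]

theorem isMatchingOff_permCongr (e : X ≃ Y) (S : Set Y) (α : Perm X) :
    IsMatchingOff S (e.permCongr α) ↔ IsMatchingOff (e ⁻¹' S) α := by
  simp [IsMatchingOff, Function.Involutive, ← e.forall_congr_right]

theorem separatesCycles_univ_iff {τ : Perm X} : SeparatesCycles Set.univ τ ↔ τ = 1 := by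
  constructor
  · exact fun h => Perm.ext fun x => h trivial trivial (Perm.sameCycle_apply_left.2 (.refl _ _))
  · rintro rfl x - y - hxy
    simpa using hxy

theorem separatesCycles_option_iff {S : Set (Option X)} (hS : none ∉ S) (τ : Perm (Option X)) :
    SeparatesCycles S τ ↔ SeparatesCycles (some ⁻¹' S) (removeNone τ) := by
  simp [SeparatesCycles, Option.forall, hS, sameCycle_removeNone]

theorem card_separatesCycles_option [Finite X] {S : Set (Option X)} (hS : none ∉ S) :
    Nat.card {τ : Perm (Option X) // SeparatesCycles S τ} =
      (Nat.card X + 1) * Nat.card {τ : Perm X // SeparatesCycles (some ⁻¹' S) τ} := by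
  classical
  rw [← Finite.card_option, ← Nat.card_prod]
  refine Nat.card_congr ((Perm.decomposeOption.subtypeEquiv
    (q := fun p => True ∧ SeparatesCycles (some ⁻¹' S) p.2) fun τ => ?_).trans
    (subtypeProdEquivProd.trans ((Equiv.subtypeUnivEquiv fun _ => trivial).prodCongr (.refl _))))
  simpa using separatesCycles_option_iff hS τ

theorem card_separatesCycles_mul_factorial [Finite X] (S : Set X) :
    Nat.card {τ : Perm X // SeparatesCycles S τ} * S.ncard.factorial =
      (Nat.card X).factorial := by
  classical
  obtain ⟨k, hk⟩ := Nat.exists_eq_add_of_le (Set.ncard_le_card S)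
  induction k generalizing X with
  | zero =>
    obtain rfl : S = Set.univ := by
      by_contra hS
      exact (Set.ncard_lt_card hS).ne hk.symm
    simp [separatesCycles_univ_iff]
  | succ k ih =>
    obtain ⟨x₀, hx₀⟩ : ∃ x, x ∉ S := by
      by_contra! hS
      simp [Set.eq_univ_of_forall hS] at hk
    let e := optionSubtypeNe x₀
    have hcard : Nat.card X = Nat.card {x // x ≠ x₀} + 1 := by
      rw [← Finite.card_option, Nat.card_congr e]
    have hncard : (some ⁻¹' (e ⁻¹' S)).ncard = S.ncard := by
      rw [← Set.preimage_comp, Set.ncard_preimage_of_injective_subset_range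
        (e.injective.comp (Option.some_injective _))]
      intro x hx
      have hne : x ≠ x₀ := fun h => hx₀ (h ▸ hx)
      exact ⟨⟨x, hne⟩, optionSubtypeNe_some x₀ ⟨x, hne⟩⟩
    have hstep := ih (some ⁻¹' (e ⁻¹' S)) (by omega)
    rw [Nat.card_congr (e.permCongr.subtypeEquiv fun τ =>
      (separatesCycles_permCongr e S τ).symm).symm,
      card_separatesCycles_option (by simpa [e] using hx₀), hcard, Nat.factorial_succ, ← hstep,
      hncard, mul_assoc]

theorem involutive_and_forall_ne_iff_cycleType_eq [Fintype X] [DecidableEq X] {e : ℕ}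
    (hX : Fintype.card X = 2 * e) (α : Perm X) :
    (Function.Involutive α ∧ ∀ x, α x ≠ x) ↔ α.cycleType = Multiset.replicate e 2 := by
  have hinv : Function.Involutive α ↔ ∀ c ∈ α.cycleType, c = 2 := by
    rw [← Perm.pow_prime_eq_one_iff, Perm.ext_iff]
    simp [sq, Function.Involutive]
  have hfix : (∀ x, α x ≠ x) ↔ α.cycleType.sum = 2 * e := by
    rw [Perm.sum_cycleType, ← hX, Finset.card_eq_iff_eq_univ, Finset.eq_univ_iff_forall]
    simp
  rw [hinv, hfix, Multiset.eq_replicate, and_comm, and_congr_left_iff]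
  intro h
  rw [Multiset.eq_replicate_card.2 h, Multiset.sum_replicate, Multiset.card_replicate,
    smul_eq_mul, mul_comm, Nat.mul_right_inj two_ne_zero]

theorem even_card_of_involutive_of_forall_ne [Finite X] {α : Perm X}
    (hinv : Function.Involutive α) (hfix : ∀ x, α x ≠ x) : Even (Nat.card X) := by
  classical
  have := Fintype.ofFinite X
  by_contra hX
  rw [Nat.card_eq_fintype_card] at hX
  obtain ⟨x, hx⟩ := Perm.exists_fixed_point_of_prime (p := 2) (n := 1) (σ := α)
    (by rwa [← even_iff_two_dvd]) (by ext x; simp [sq, hinv x])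
  exact hfix x hx

theorem card_fixedPointFree_involutions [Finite X] :
    Nat.card {α : Perm X // Function.Involutive α ∧ ∀ x, α x ≠ x} =
      if Even (Nat.card X) then (Nat.card X - 1).doubleFactorial else 0 := by
  classical
  have := Fintype.ofFinite X
  split_ifs with hX
  · obtain ⟨e, he⟩ := hX.exists_two_nsmul
    rw [smul_eq_mul] at he
    have hX : Fintype.card X = 2 * e := by rw [← he, Nat.card_eq_fintype_card]
    simp only [involutive_and_forall_ne_iff_cycleType_eq hX]
    rw [Nat.card_eq_fintype_card, Fintype.card_subtype, he]
    have hmul := Perm.card_of_cycleType_mul_eq X (Multiset.replicate e 2)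
    rw [if_pos ⟨by simp [hX, mul_comm], fun a ha => (Multiset.eq_of_mem_replicate ha).ge⟩] at hmul
    have hfact : (2 * e).factorial = (2 * e - 1).doubleFactorial * (2 ^ e * e.factorial) := by
      rcases e with _ | k
      · rfl
      · rw [← Nat.doubleFactorial_two_mul, mul_comm (Nat.doubleFactorial _)]
        exact Nat.factorial_eq_mul_doubleFactorial (2 * k + 1)
    have hcount : ∏ n ∈ (Multiset.replicate e 2).toFinset,
        ((Multiset.replicate e 2).count n).factorial = e.factorial := by
      rcases eq_or_ne e 0 with rfl | h
      · rfl
      · simp [Multiset.toFinset_replicate, h]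
    refine Nat.eq_of_mul_eq_mul_right (m := 2 ^ e * e.factorial) (by positivity) ?_
    rw [← hfact, ← hX, ← hmul, hcount]
    simp [hX, mul_comm e 2]
  · rw [Nat.card_eq_zero]
    exact .inl ⟨fun α => hX (even_card_of_involutive_of_forall_ne α.2.1 α.2.2)⟩

theorem isMatchingOff_ofSubtype_iff {S : Set X} [DecidablePred (· ∈ Sᶜ)] (α : Perm ↥Sᶜ) :
    IsMatchingOff S (Perm.ofSubtype α) ↔ Function.Involutive α ∧ ∀ x, α x ≠ x := by
  have hout {x : X} (hx : x ∈ S) : Perm.ofSubtype α x = x :=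
    Perm.ofSubtype_apply_of_not_mem α (not_not.2 hx)
  have hin (x : X) (hx : x ∈ Sᶜ) : Perm.ofSubtype α x = α ⟨x, hx⟩ :=
    Perm.ofSubtype_apply_of_mem α hx
  constructor
  · rintro ⟨hinv, hfix⟩
    refine ⟨fun x => Subtype.ext ?_, fun x hx => x.2 ((hfix x).1 ?_)⟩
    · simpa using hinv x
    · simp [hx]
  · rintro ⟨hinv, hfix⟩
    refine ⟨fun x => ?_, fun x => ?_⟩ <;> by_cases hx : x ∈ S
    · rw [hout hx, hout hx]
    · rw [hin x hx, Perm.ofSubtype_apply_coe, hinv]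
    · exact iff_of_true (hout hx) hx
    · refine iff_of_false (fun h => hfix ⟨x, hx⟩ (Subtype.ext ?_)) hx
      rwa [hin x hx] at h

theorem card_isMatchingOff [Finite X] (S : Set X) :
    Nat.card {α : Perm X // IsMatchingOff S α} =
      if Even Sᶜ.ncard then (Sᶜ.ncard - 1).doubleFactorial else 0 := by
  classical
  rw [← Nat.card_coe_set_eq, ← card_fixedPointFree_involutions]
  symm
  exact Nat.card_congr <| ((Perm.subtypeEquivSubtypePerm (· ∈ Sᶜ)).subtypeEquiv
    (q := fun α => IsMatchingOff S α.1) fun α => (isMatchingOff_ofSubtype_iff α).symm).trans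
    (Equiv.subtypeSubtypeEquivSubtype fun {α} h x hx => (h.2 x).2 (not_not.1 hx))

theorem forall_iff_forall_mem_and_forall_notMem (C : Set X) {P : X → Prop} :
    (∀ x, P x) ↔ (∀ x : C, P x) ∧ ∀ x : {x // x ∉ C}, P x := by
  classical
  rw [← (Equiv.sumCompl (· ∈ C)).forall_congr_right, Sum.forall]
  rfl

section SubtypeCongr

variable {S C : Set X} [DecidablePred (· ∈ C)]

theorem isMatchingOff_subtypeCongr_iff {α : Perm C} {β : Perm {x // x ∉ C}} :
    IsMatchingOff S (α.subtypeCongr β) ↔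
      IsMatchingOff (Subtype.val ⁻¹' S) α ∧ IsMatchingOff (Subtype.val ⁻¹' S) β := by
  simp only [IsMatchingOff, Function.Involutive, Set.mem_preimage,
    forall_iff_forall_mem_and_forall_notMem C, Perm.subtypeCongr.left_apply_subtype,
    Perm.subtypeCongr.right_apply_subtype, SetCoe.ext_iff, ← Subtype.ext_iff]
  exact and_and_and_comm

theorem subtypeCongr_apply_mem_iff (σ : Perm C) (τ : Perm {x // x ∉ C}) (x : X) :
    σ.subtypeCongr τ x ∈ C ↔ x ∈ C := by
  by_cases hx : x ∈ C
  · simp [Perm.subtypeCongr.left_apply _ _ hx, hx]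
  · simpa [Perm.subtypeCongr.right_apply _ _ hx, hx] using (τ ⟨x, hx⟩).2

theorem separatesCycles_subtypeCongr_iff {σ : Perm C} {τ : Perm {x // x ∉ C}} :
    SeparatesCycles S (σ.subtypeCongr τ) ↔
      SeparatesCycles (Subtype.val ⁻¹' S) σ ∧ SeparatesCycles (Subtype.val ⁻¹' S) τ := by
  have hσ (x y : C) : (σ.subtypeCongr τ).SameCycle x y ↔ σ.SameCycle x y :=
    sameCycle_apply_iff_of_injective Subtype.val_injective (by simp)
  have hτ (x y : {x // x ∉ C}) : (σ.subtypeCongr τ).SameCycle x y ↔ τ.SameCycle x y :=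
    sameCycle_apply_iff_of_injective Subtype.val_injective (by simp)
  have hmem {x y : X} (h : (σ.subtypeCongr τ).SameCycle x y) : x ∈ C ↔ y ∈ C := by
    have hC : PermPair.IsInvariant (1, σ.subtypeCongr τ) C :=
      ⟨fun _ => Iff.rfl, subtypeCongr_apply_mem_iff σ τ⟩
    rw [← PermPair.mem_component_one_iff] at h
    exact ⟨fun hx => hC.component_subset hx h,
      not_imp_not.1 fun hx => hC.compl.component_subset hx h⟩
  constructor
  · exact fun h => ⟨fun x hx y hy hxy => Subtype.ext (h hx hy ((hσ x y).2 hxy)),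
      fun x hx y hy hxy => Subtype.ext (h hx hy ((hτ x y).2 hxy))⟩
  · rintro ⟨h₁, h₂⟩ x hx y hy hxy
    by_cases hxC : x ∈ C
    · have hyC := (hmem hxy).1 hxC
      exact congrArg Subtype.val
        (h₁ (x := ⟨x, hxC⟩) hx (y := ⟨y, hyC⟩) hy ((hσ _ _).1 hxy))
    · have hyC := (not_congr (hmem hxy)).1 hxC
      exact congrArg Subtype.val
        (h₂ (x := ⟨x, hxC⟩) hx (y := ⟨y, hyC⟩) hy ((hτ _ _).1 hxy))

end SubtypeCongr

namespace PermPair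

/-- The combinatorial objects that are counted: `p.1` matches the points outside `S`, and `S` is a
set of marks on distinct cycles of `p.2`. -/
def IsMarked (S : Set X) (p : PermPair X) : Prop :=
  IsMatchingOff S p.1 ∧ SeparatesCycles S p.2

theorem isMarked_permCongr (e : X ≃ Y) (S : Set Y) (p : PermPair X) :
    IsMarked S (e.permCongr p.1, e.permCongr p.2) ↔ p.IsMarked (e ⁻¹' S) := by
  simp only [IsMarked, isMatchingOff_permCongr, separatesCycles_permCongr]

theorem card_isMarked_mul_factorial [Finite X] (S : Set X) :
    Nat.card {p : PermPair X // p.IsMarked S} * S.ncard.factorial =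
      (if Even Sᶜ.ncard then (Sᶜ.ncard - 1).doubleFactorial else 0) *
        (Nat.card X).factorial := by
  have hprod : Nat.card {p : PermPair X // p.IsMarked S} =
      Nat.card {α : Perm X // IsMatchingOff S α} *
        Nat.card {τ : Perm X // SeparatesCycles S τ} := by
    rw [← Nat.card_prod, ← Nat.card_congr subtypeProdEquivProd]
    rfl
  rw [hprod, card_isMatchingOff, mul_assoc, card_separatesCycles_mul_factorial]

section Glue

variable {S C : Set X} [DecidablePred (· ∈ C)]

/-- The disjoint union of a pair on `C` and a pair on the complement of `C`. -/
def glue (q : PermPair C) (r : PermPair {x // x ∉ C}) : PermPair X :=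
  (q.1.subtypeCongr r.1, q.2.subtypeCongr r.2)

theorem isInvariant_glue (q : PermPair C) (r : PermPair {x // x ∉ C}) :
    (glue q r).IsInvariant C :=
  ⟨subtypeCongr_apply_mem_iff q.1 r.1, subtypeCongr_apply_mem_iff q.2 r.2⟩

theorem glue_inj {q q' : PermPair C} {r r' : PermPair {x // x ∉ C}} :
    glue q r = glue q' r' ↔ q = q' ∧ r = r' := by
  have h (a b : Perm C × Perm {x // x ∉ C}) :
      a.1.subtypeCongr a.2 = b.1.subtypeCongr b.2 ↔ a = b :=
    (Perm.subtypeCongrHom_injective (· ∈ C)).eq_iff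
  simp only [glue, Prod.ext_iff] at h ⊢
  rw [h (q.1, r.1) (q'.1, r'.1), h (q.2, r.2) (q'.2, r'.2)]
  exact and_and_and_comm

theorem IsInvariant.exists_glue_eq {p : PermPair X} (hp : p.IsInvariant C) :
    ∃ (q : PermPair C) (r : PermPair {x // x ∉ C}), glue q r = p := by
  have subtypeCongr_subtypePerm (f : Perm X) (hf : ∀ x, f x ∈ C ↔ x ∈ C) :
      (f.subtypePerm hf).subtypeCongr (f.subtypePerm fun x => not_congr (hf x)) = f := by
    ext x
    by_cases hx : x ∈ C
    · rw [Perm.subtypeCongr.left_apply _ _ hx, Perm.subtypePerm_apply]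
    · rw [Perm.subtypeCongr.right_apply _ _ hx, Perm.subtypePerm_apply]
  exact ⟨(p.1.subtypePerm hp.1, p.2.subtypePerm hp.2),
    (p.1.subtypePerm fun x => not_congr (hp.1 x), p.2.subtypePerm fun x => not_congr (hp.2 x)),
    Prod.ext (subtypeCongr_subtypePerm p.1 hp.1) (subtypeCongr_subtypePerm p.2 hp.2)⟩

theorem isMarked_glue_iff {q : PermPair C} {r : PermPair {x // x ∉ C}} :
    (glue q r).IsMarked S ↔ q.IsMarked (Subtype.val ⁻¹' S) ∧ r.IsMarked (Subtype.val ⁻¹' S) := by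
  simp only [IsMarked, glue, isMatchingOff_subtypeCongr_iff, separatesCycles_subtypeCongr_iff]
  exact and_and_and_comm

theorem component_glue_eq_iff {q : PermPair C} {r : PermPair {x // x ∉ C}} (x : C) :
    (glue q r).component x = C ↔ q.IsConnected := by
  have hsub := (isInvariant_glue q r).component_subset x.2
  rw [isConnected_iff_component_eq_univ x, Set.eq_univ_iff_forall,
    Set.Subset.antisymm_iff, and_iff_right hsub, Set.subset_def]
  refine SetCoe.forall'.trans (forall_congr' fun y =>
    apply_mem_component_iff_of_injective Subtype.val_injective ?_ ?_)
  all_goals simp [glue]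

end Glue

theorem card_isMarked_component_eq (S C : Set X) {x : X} (hx : x ∈ C) :
    Nat.card {p : PermPair X // p.IsMarked S ∧ p.component x = C} =
      Nat.card {q : PermPair C // q.IsMarked (Subtype.val ⁻¹' S) ∧ q.IsConnected} *
        Nat.card {r : PermPair {x // x ∉ C} // r.IsMarked (Subtype.val ⁻¹' S)} := by
  classical
  rw [← Nat.card_prod]
  symm
  refine Nat.card_congr (Equiv.ofBijective (fun a => ⟨glue a.1.1 a.2.1,
    isMarked_glue_iff.2 ⟨a.1.2.1, a.2.2⟩, (component_glue_eq_iff ⟨x, hx⟩).2 a.1.2.2⟩) ⟨?_, ?_⟩)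
  · rintro ⟨q, r⟩ ⟨q', r'⟩ h
    obtain ⟨hq, hr⟩ := glue_inj.1 (congrArg Subtype.val h)
    exact Prod.ext (Subtype.ext hq) (Subtype.ext hr)
  · rintro ⟨p, hp, hC⟩
    obtain ⟨q, r, rfl⟩ := (hC ▸ p.isInvariant_component x : p.IsInvariant C).exists_glue_eq
    obtain ⟨hq, hr⟩ := isMarked_glue_iff.1 hp
    exact ⟨(⟨q, hq, (component_glue_eq_iff ⟨x, hx⟩).1 hC⟩, ⟨r, hr⟩), rfl⟩

/-- The number of marked pairs on `n` unmarked and `N` marked points. -/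
noncomputable def markedCount (n N : ℕ) : ℕ :=
  Nat.card {p : PermPair (Fin n ⊕ Fin N) // p.IsMarked (Set.range Sum.inr)}

/-- The number of connected marked pairs on `n` unmarked and `N` marked points. -/
noncomputable def connectedMarkedCount (n N : ℕ) : ℕ :=
  Nat.card {p : PermPair (Fin n ⊕ Fin N) // p.IsMarked (Set.range Sum.inr) ∧ p.IsConnected}

theorem exists_equiv_fin_sum_fin [Finite X] (S : Set X) :
    ∃ e : X ≃ Fin Sᶜ.ncard ⊕ Fin S.ncard, e ⁻¹' Set.range Sum.inr = S := by
  classical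
  let e : Fin Sᶜ.ncard ⊕ Fin S.ncard ≃ X := (sumComm _ _).trans
    (((Finite.equivFin S).symm.sumCongr (Finite.equivFin ↥Sᶜ).symm).trans (Equiv.sumCompl (· ∈ S)))
  refine ⟨e.symm, Set.ext fun x => ?_⟩
  obtain ⟨y | y, rfl⟩ := e.surjective x
  · refine iff_of_false ?_ ((Finite.equivFin ↥Sᶜ).symm y).2
    rw [Set.mem_preimage, e.symm_apply_apply]
    simp
  · refine iff_of_true ?_ ((Finite.equivFin S).symm y).2
    rw [Set.mem_preimage, e.symm_apply_apply]
    exact Set.mem_range_self y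

theorem card_isMarked_eq_markedCount [Finite X] (S : Set X) :
    Nat.card {p : PermPair X // p.IsMarked S} = markedCount Sᶜ.ncard S.ncard := by
  obtain ⟨e, he⟩ := exists_equiv_fin_sum_fin S
  have h (p : PermPair X) := isMarked_permCongr e (Set.range Sum.inr) p
  rw [he] at h
  exact Nat.card_congr ((e.permCongr.prodCongr e.permCongr).subtypeEquiv fun p => (h p).symm)

theorem card_isMarked_isConnected_eq_connectedMarkedCount [Finite X] (S : Set X) :
    Nat.card {p : PermPair X // p.IsMarked S ∧ p.IsConnected} =
      connectedMarkedCount Sᶜ.ncard S.ncard := by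
  obtain ⟨e, he⟩ := exists_equiv_fin_sum_fin S
  have h (p : PermPair X) := isMarked_permCongr e (Set.range Sum.inr) p
  rw [he] at h
  exact Nat.card_congr ((e.permCongr.prodCongr e.permCongr).subtypeEquiv fun p =>
    (and_congr (h p) (isConnected_permCongr e p)).symm)

theorem ncard_range_inr (n : ℕ) (β : Type*) :
    (Set.range (Sum.inr : β → Fin n ⊕ β)).ncard = Nat.card β := by
  rw [← Set.image_univ, Set.ncard_image_of_injective _ Sum.inr_injective, Set.ncard_univ]

theorem ncard_compl_range_inr (n : ℕ) (β : Type*) :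
    (Set.range (Sum.inr : β → Fin n ⊕ β))ᶜ.ncard = n := by
  rw [Set.compl_range_inr, ← Set.image_univ, Set.ncard_image_of_injective _ Sum.inl_injective,
    Set.ncard_univ, Nat.card_fin]

theorem markedCount_mul_factorial (n N : ℕ) :
    markedCount n N * N.factorial =
      (if Even n then (n - 1).doubleFactorial else 0) * (n + N).factorial := by
  have h := card_isMarked_mul_factorial (Set.range (Sum.inr : Fin N → Fin n ⊕ Fin N))
  rwa [ncard_range_inr, ncard_compl_range_inr, Nat.card_sum, Nat.card_fin, Nat.card_fin] at h

theorem ncard_preimage_val (S C : Set X) :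
    ((Subtype.val : C → X) ⁻¹' S).ncard = (C ∩ S).ncard := by
  rw [← Subtype.image_preimage_coe, Set.ncard_image_of_injective _ Subtype.val_injective]

theorem card_isMarked_component_eq_mul [Finite X] (S C : Set X) {x : X} (hx : x ∈ C) :
    Nat.card {p : PermPair X // p.IsMarked S ∧ p.component x = C} =
      connectedMarkedCount (C \ S).ncard (C ∩ S).ncard *
        markedCount (Cᶜ \ S).ncard (Cᶜ ∩ S).ncard := by
  have h (D : Set X) : ((Subtype.val : D → X) ⁻¹' S)ᶜ.ncard = (D \ S).ncard :=
    ncard_preimage_val Sᶜ D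
  have hnot := card_isMarked_eq_markedCount ((Subtype.val : ↥Cᶜ → X) ⁻¹' S)
  rw [h, ncard_preimage_val] at hnot
  rw [card_isMarked_component_eq S C hx, card_isMarked_isConnected_eq_connectedMarkedCount, h,
    ncard_preimage_val, ← hnot]
  rfl

theorem card_isMarked_component_eq_disjSum {n N : ℕ} (A : Finset (Fin n)) (J : Finset (Fin N)) :
    Nat.card {p : PermPair (Fin n ⊕ Option (Fin N)) // p.IsMarked (Set.range Sum.inr) ∧
        p.component (Sum.inr none) = A.disjSum J.insertNone} =
      connectedMarkedCount A.card (J.card + 1) * markedCount (n - A.card) (N - J.card) := by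
  classical
  have hdiff (A : Finset (Fin n)) (B : Finset (Option (Fin N))) :
      ((A.disjSum B : Set (Fin n ⊕ Option (Fin N))) \ Set.range Sum.inr).ncard = A.card := by
    rw [← Set.ncard_coe_finset, ← Set.ncard_image_of_injective (↑A : Set (Fin n)) Sum.inl_injective]
    exact congrArg Set.ncard (by ext (x | x) <;> simp)
  have hinter (A : Finset (Fin n)) (B : Finset (Option (Fin N))) :
      ((A.disjSum B : Set (Fin n ⊕ Option (Fin N))) ∩ Set.range Sum.inr).ncard = B.card := by
    rw [← Set.ncard_coe_finset,
      ← Set.ncard_image_of_injective (↑B : Set (Option (Fin N))) Sum.inr_injective]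
    exact congrArg Set.ncard (by ext (x | x) <;> simp)
  have hcompl : (A.disjSum J.insertNone : Set (Fin n ⊕ Option (Fin N)))ᶜ =
      (Aᶜ.disjSum J.insertNoneᶜ : Finset _) := by
    ext (x | x) <;> simp
  rw [card_isMarked_component_eq_mul _ _ (by simp), hcompl, hdiff, hinter, hdiff, hinter]
  simp [Finset.card_compl]

theorem exists_component_eq_disjSum {n N : ℕ} (p : PermPair (Fin n ⊕ Option (Fin N))) :
    ∃ AJ : Finset (Fin n) × Finset (Fin N),
      p.component (Sum.inr none) = AJ.1.disjSum AJ.2.insertNone := by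
  classical
  let F := (p.component (Sum.inr none)).toFinset
  have hnone : none ∈ F.toRight := by simp [F, self_mem_component]
  refine ⟨(F.toLeft, F.toRight.eraseNone), ?_⟩
  rw [Finset.insertNone_eraseNone, Finset.insert_eq_of_mem hnone, Finset.toLeft_disjSum_toRight,
    Set.coe_toFinset]

theorem markedCount_succ (n N : ℕ) :
    markedCount n (N + 1) = ∑ i ∈ Finset.range (N + 1), N.choose i *
      ∑ a ∈ Finset.range (n + 1),
        n.choose a * (connectedMarkedCount a (i + 1) * markedCount (n - a) (N - i)) := by
  classical
  let P := {p : PermPair (Fin n ⊕ Option (Fin N)) // p.IsMarked (Set.range Sum.inr)}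
  have hP : Nat.card P = markedCount n (N + 1) := by
    rw [card_isMarked_eq_markedCount, ncard_range_inr, ncard_compl_range_inr, Finite.card_option,
      Nat.card_fin]
  choose f hf using fun p : P => exists_component_eq_disjSum p.1
  have hfiber (A : Finset (Fin n)) (J : Finset (Fin N)) : Nat.card {p // f p = (A, J)} =
      connectedMarkedCount A.card (J.card + 1) * markedCount (n - A.card) (N - J.card) := by
    have hiff (p : P) : f p = (A, J) ↔ p.1.component (Sum.inr none) = A.disjSum J.insertNone := by
      rw [hf, Finset.coe_inj, ← Finset.sumEquiv_symm_apply (_, _),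
        ← Finset.sumEquiv_symm_apply (_, _)]
      simp [Prod.ext_iff]
    simp_rw [hiff]
    rw [← card_isMarked_component_eq_disjSum]
    exact Nat.card_congr (Equiv.subtypeSubtypeEquivSubtypeInter (IsMarked (Set.range Sum.inr))
      fun p : PermPair (Fin n ⊕ Option (Fin N)) =>
        p.component (Sum.inr none) = A.disjSum J.insertNone)
  have sum_card (m : ℕ) (g : ℕ → ℕ) :
      ∑ A : Finset (Fin m), g A.card = ∑ a ∈ Finset.range (m + 1), m.choose a * g a := by
    simpa using Finset.sum_powerset_apply_card g (x := (Finset.univ : Finset (Fin m)))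
  rw [← hP, ← Nat.card_congr (Equiv.sigmaFiberEquiv f), Nat.card_sigma, Fintype.sum_prod_type_right]
  simp only [hfiber]
  rw [sum_card N fun i => ∑ A : Finset (Fin n),
    connectedMarkedCount A.card (i + 1) * markedCount (n - A.card) (N - i)]
  exact Finset.sum_congr rfl fun i _ => congrArg (N.choose i * ·)
    (sum_card n fun a => connectedMarkedCount a (i + 1) * markedCount (n - a) (N - i))

end PermPair

section AttachRoots

variable {H I : Type*} {r : I → H} (hr : Function.Injective r)

/-- The permutation of `H ⊕ I` that exchanges every `i : I` with its root `r i`. -/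
noncomputable def rootSwap : Perm (H ⊕ I) :=
  Function.Involutive.toPerm (Sum.elim (Function.extend r Sum.inr Sum.inl) (Sum.inl ∘ r)) <| by
    rintro (h | i)
    · by_cases hh : ∃ i, r i = h
      · obtain ⟨i, rfl⟩ := hh
        simp [hr.extend_apply]
      · simp [Function.extend_apply' _ _ _ hh]
    · simp [hr.extend_apply]

/-- The permutation obtained from `σ` by inserting every `i : I` into a cycle, just in front of its
root `r i`. -/
noncomputable def attachRoots (σ : Perm H) : Perm (H ⊕ I) :=
  rootSwap hr * sumCongr σ 1

theorem rootSwap_inl (h : H) : rootSwap hr (Sum.inl h) = Function.extend r Sum.inr Sum.inl h :=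
  rfl

theorem elim_id_rootSwap (z : H ⊕ I) : Sum.elim id r (rootSwap hr z) = Sum.elim id r z := by
  rcases z with h | i
  · by_cases hh : ∃ i, r i = h
    · obtain ⟨i, rfl⟩ := hh
      simp [rootSwap_inl, hr.extend_apply]
    · simp [rootSwap_inl, Function.extend_apply' _ _ _ hh]
  · rfl

-- Contracting each mark to its root identifies the two families of invariant sets.
theorem isInvariant_attachRoots_iff (α σ : Perm H) (s : Set (H ⊕ I)) :
    PermPair.IsInvariant (sumCongr α 1, attachRoots hr σ) s ↔
      ∃ t, PermPair.IsInvariant (α, σ) t ∧ Sum.elim id r ⁻¹' t = s := by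
  have hσ (h : H) : Sum.elim id r (attachRoots hr σ (Sum.inl h)) = σ h :=
    elim_id_rootSwap hr (Sum.inl (σ h))
  constructor
  · rintro ⟨hsα, hsσ⟩
    have hs : Sum.elim id r ⁻¹' (Sum.inl ⁻¹' s) = s := by
      ext (h | i)
      · rfl
      · exact hsσ (Sum.inr i)
    refine ⟨Sum.inl ⁻¹' s, ⟨fun h => hsα (Sum.inl h), fun h => ?_⟩, hs⟩
    rw [← hσ, ← Set.mem_preimage, hs, hsσ, Set.mem_preimage]
  · rintro ⟨t, ⟨htα, htσ⟩, rfl⟩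
    refine ⟨?_, ?_⟩
    · rintro (h | i)
      · exact htα h
      · rfl
    · rintro (h | i)
      · rw [Set.mem_preimage, hσ]
        exact htσ h
      · rfl

theorem sameCycle_attachRoots (σ : Perm H) (i j : I) :
    (attachRoots hr σ).SameCycle (Sum.inr i) (Sum.inr j) ↔ σ.SameCycle (r i) (r j) := by
  rw [← PermPair.mem_component_one_iff, ← PermPair.mem_component_one_iff, iff_comm,
    ← Perm.sumCongr_one]
  exact PermPair.apply_mem_component_iff (Sum.elim id r) (isInvariant_attachRoots_iff hr 1 σ)
    (x := Sum.inr i) (y := Sum.inr j)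

theorem isConnected_attachRoots_iff (α σ : Perm H) :
    PermPair.IsConnected (sumCongr α 1, attachRoots hr σ) ↔ PermPair.IsConnected (α, σ) := by
  rw [iff_comm]
  exact PermPair.isConnected_iff_of_surjective (fun h => ⟨Sum.inl h, rfl⟩) fun _ _ =>
    PermPair.apply_mem_component_iff (Sum.elim id r) (isInvariant_attachRoots_iff hr α σ)

theorem exists_sumCongr_one_eq [Finite H] [Finite I] {g : Perm (H ⊕ I)}
    (hg : ∀ i, g (Sum.inr i) = Sum.inr i) : ∃ σ : Perm H, sumCongr σ 1 = g := by
  have hmaps : Set.MapsTo g (Set.range Sum.inl) (Set.range Sum.inl) := by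
    rintro _ ⟨h, rfl⟩
    by_contra hgh
    rw [← Set.mem_compl_iff, Set.compl_range_inl] at hgh
    obtain ⟨i, hi⟩ := hgh
    rw [← hg i] at hi
    exact Sum.inr_ne_inl (g.injective hi)
  obtain ⟨⟨σ, ι⟩, rfl⟩ := Perm.mem_sumCongrHom_range_of_perm_mapsTo_inl hmaps
  obtain rfl : ι = 1 := Perm.ext fun i => Sum.inr_injective (hg i)
  exact ⟨σ, rfl⟩

theorem exists_attachRoots_eq [Finite H] [Finite I] {τ : Perm (H ⊕ I)}
    (hτ : ∀ i, τ (Sum.inr i) ∈ Set.range Sum.inl) :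
    ∃ (r : I → H) (hr : Function.Injective r) (σ : Perm H), attachRoots hr σ = τ := by
  choose r hτr using hτ
  have hr : Function.Injective r := fun i j hij =>
    Sum.inr_injective (τ.injective (by rw [← hτr, ← hτr, hij]))
  obtain ⟨σ, hσ⟩ := exists_sumCongr_one_eq (g := (rootSwap hr)⁻¹ * τ) fun i => by
    rw [Perm.mul_apply, ← hτr, Perm.inv_eq_iff_eq]
    rfl
  exact ⟨r, hr, σ, by rw [attachRoots, hσ, mul_inv_cancel_left]⟩

theorem isMatchingOff_sumCongr_one_iff (α : Perm H) :
    IsMatchingOff (Set.range (Sum.inr : I → H ⊕ I)) (sumCongr α 1) ↔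
      Function.Involutive α ∧ ∀ h, α h ≠ h := by
  simp [IsMatchingOff, Function.Involutive]

theorem separatesCycles_attachRoots_iff (σ : Perm H) :
    SeparatesCycles (Set.range Sum.inr) (attachRoots hr σ) ↔
      ∀ i j, i ≠ j → ¬ σ.SameCycle (r i) (r j) := by
  simp [SeparatesCycles, sameCycle_attachRoots, not_imp_not]

theorem PermPair.IsMarked.apply_inr_mem_range_inl [Nonempty H] {p : PermPair (H ⊕ I)}
    (hp : p.IsMarked (Set.range Sum.inr)) (hconn : p.IsConnected) (i : I) :
    p.2 (Sum.inr i) ∈ Set.range Sum.inl := by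
  by_contra hi
  rw [← Set.mem_compl_iff, Set.compl_range_inl] at hi
  have hfix : p.2 (Sum.inr i) = Sum.inr i :=
    (hp.2 ⟨i, rfl⟩ hi (Perm.sameCycle_apply_right.2 (.refl _ _))).symm
  have hsingle {f : Perm (H ⊕ I)} (hf : f (Sum.inr i) = Sum.inr i) (x : H ⊕ I) :
      f x ∈ ({Sum.inr i} : Set (H ⊕ I)) ↔ x ∈ ({Sum.inr i} : Set (H ⊕ I)) := by
    simpa [hf] using f.apply_eq_iff_eq (x := x) (y := Sum.inr i)
  have huniv := hconn.eq_univ ⟨hsingle ((hp.1.2 _).2 ⟨i, rfl⟩), hsingle hfix⟩ rfl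
  exact Sum.inl_ne_inr (huniv.ge (Set.mem_univ (Sum.inl (Classical.arbitrary H))))

end AttachRoots

namespace NRootedGraph

variable {N e : ℕ}

theorem ext_of_eq {G G' : NRootedGraph N e} (hα : G.α = G'.α) (hσ : G.σ = G'.σ)
    (hroot : G.root = G'.root) : G = G' := by
  rcases G with ⟨⟨α, σ, _, _, _⟩, r, _⟩
  rcases G' with ⟨⟨α', σ', _, _, _⟩, r', _⟩
  dsimp only at hα hσ hroot
  subst hα hσ hroot
  rfl

theorem root_injective (G : NRootedGraph N e) : Function.Injective G.root := fun i j hij => by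
  by_contra hne
  exact G.distinctVertices i j hne (hij ▸ Perm.SameCycle.refl _ _)

/-- The encoding of a rooted graph by a pair of permutations in which the `k`-th root is recorded
by an extra point, inserted into its cycle. -/
noncomputable def toPermPair (G : NRootedGraph N e) : PermPair (Fin (2 * e) ⊕ Fin N) :=
  (sumCongr G.α 1, attachRoots G.root_injective G.σ)

theorem isMarked_toPermPair (G : NRootedGraph N e) : G.toPermPair.IsMarked (Set.range Sum.inr) :=
  ⟨(isMatchingOff_sumCongr_one_iff _).2 ⟨G.involutive, G.fixedPointFree⟩,
    (separatesCycles_attachRoots_iff _ _).2 G.distinctVertices⟩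

theorem isConnected_toPermPair (G : NRootedGraph N e) : G.toPermPair.IsConnected :=
  (isConnected_attachRoots_iff _ _ _).2 G.transitive

theorem toPermPair_injective : Function.Injective (toPermPair : NRootedGraph N e → _) := by
  intro G G' h
  obtain ⟨hα, hτ⟩ := Prod.ext_iff.1 h
  have hroot : G.root = G'.root :=
    funext fun i => Sum.inl_injective (Perm.congr_fun hτ (Sum.inr i))
  refine ext_of_eq (Perm.ext fun x => Sum.inl_injective (Perm.congr_fun hα (Sum.inl x))) ?_ hroot
  refine Perm.ext fun x => Sum.inl_injective ((rootSwap G.root_injective).injective ?_)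
  have hx := Perm.congr_fun hτ (Sum.inl x)
  simp only [toPermPair, attachRoots, ← hroot] at hx
  exact hx

theorem exists_toPermPair_eq [NeZero e] {p : PermPair (Fin (2 * e) ⊕ Fin N)}
    (hp : p.IsMarked (Set.range Sum.inr)) (hconn : p.IsConnected) :
    ∃ G : NRootedGraph N e, G.toPermPair = p := by
  obtain ⟨α', τ⟩ := p
  obtain ⟨α, rfl⟩ := exists_sumCongr_one_eq fun i => (hp.1.2 _).2 ⟨i, rfl⟩
  obtain ⟨r, hr, σ, rfl⟩ := exists_attachRoots_eq (hp.apply_inr_mem_range_inl hconn)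
  obtain ⟨hinv, hfix⟩ := (isMatchingOff_sumCongr_one_iff α).1 hp.1
  exact ⟨⟨⟨α, σ, hinv, hfix, (isConnected_attachRoots_iff hr α σ).1 hconn⟩, r,
    (separatesCycles_attachRoots_iff hr σ).1 hp.2⟩, rfl⟩

theorem card_eq_connectedMarkedCount [NeZero e] :
    Nat.card (NRootedGraph N e) = PermPair.connectedMarkedCount (2 * e) N := by
  refine Nat.card_congr (Equiv.ofBijective
    (fun G => ⟨G.toPermPair, G.isMarked_toPermPair, G.isConnected_toPermPair⟩) ⟨?_, ?_⟩)
  · exact fun G G' h => toPermPair_injective (congrArg Subtype.val h)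
  · rintro ⟨p, hp, hconn⟩
    obtain ⟨G, rfl⟩ := exists_toPermPair_eq hp hconn
    exact ⟨G, rfl⟩

/-- Permutations of the half-edges act on rooted graphs by relabelling; isomorphism classes are the
orbits. -/
instance : MulAction (Perm (Fin (2 * e))) (NRootedGraph N e) where
  smul ψ G :=
    { α := ψ.permCongr G.α
      σ := ψ.permCongr G.σ
      involutive := fun h => by simp [G.involutive]
      fixedPointFree := fun h => by simp [← Equiv.eq_symm_apply, G.fixedPointFree]
      transitive := (PermPair.isConnected_permCongr ψ (G.α, G.σ)).2 G.transitive
      root := ψ ∘ G.root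
      distinctVertices := fun i j hij h => G.distinctVertices i j hij <|
        (sameCycle_apply_iff_of_injective ψ.injective fun x => by simp).1 h }
  one_smul _ := rfl
  mul_smul _ _ _ := rfl

theorem smul_eq_iff {ψ : Perm (Fin (2 * e))} {G G' : NRootedGraph N e} :
    ψ • G = G' ↔ (∀ h, G'.α (ψ h) = ψ (G.α h)) ∧ (∀ h, G'.σ (ψ h) = ψ (G.σ h)) ∧
      ∀ k, ψ (G.root k) = G'.root k := by
  constructor
  · rintro rfl
    exact ⟨fun h => congrArg (ψ ∘ G.α) (ψ.symm_apply_apply h),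
      fun h => congrArg (ψ ∘ G.σ) (ψ.symm_apply_apply h), fun _ => rfl⟩
  · rintro ⟨hα, hσ, hroot⟩
    refine ext_of_eq (Perm.ext fun x => ?_) (Perm.ext fun x => ?_) (funext hroot)
    · exact (hα (ψ.symm x)).symm.trans (congrArg G'.α (ψ.apply_symm_apply x))
    · exact (hσ (ψ.symm x)).symm.trans (congrArg G'.σ (ψ.apply_symm_apply x))

theorem isoSetoid_eq_orbitRel :
    isoSetoid N e = MulAction.orbitRel (Perm (Fin (2 * e))) (NRootedGraph N e) :=
  Setoid.ext fun _ _ => (exists_congr fun _ => smul_eq_iff.symm).trans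
    MulAction.mem_orbit_symm

theorem stabilizer_eq_bot [NeZero N] (G : NRootedGraph N e) :
    MulAction.stabilizer (Perm (Fin (2 * e))) G = ⊥ := by
  rw [eq_bot_iff]
  intro ψ hψ
  obtain ⟨hα, hσ, hroot⟩ := smul_eq_iff.1 hψ
  have hconn : PermPair.IsConnected (G.α, G.σ) := G.transitive
  have hinv : PermPair.IsInvariant (G.α, G.σ) {x | ψ x = x} :=
    ⟨fun x => by simp [← hα], fun x => by simp [← hσ]⟩
  exact Perm.ext (Set.eq_univ_iff_forall.1 (hconn.eq_univ hinv (hroot 0)))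

theorem card_eq_card_quotient_mul_factorial [NeZero N] :
    Nat.card (NRootedGraph N e) = Nat.card (Quotient (isoSetoid N e)) * (2 * e).factorial := by
  rw [isoSetoid_eq_orbitRel, Nat.card_congr (MulAction.selfEquivOrbitsQuotientProd
    (stabilizer_eq_bot (N := N) (e := e))), Nat.card_prod, Nat.card_perm, Nat.card_fin]

end NRootedGraph

namespace PermPair

theorem isConnected_one_iff : IsConnected (1 : PermPair X) ↔ Subsingleton X := by
  refine ⟨fun h => ⟨fun x y => ?_⟩, fun _ => ⟨fun x y => ⟨1, Subsingleton.elim _ _⟩⟩⟩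
  have hinv : IsInvariant (1 : PermPair X) {y} := ⟨fun _ => Iff.rfl, fun _ => Iff.rfl⟩
  exact Set.eq_univ_iff_forall.1 (h.eq_univ hinv rfl) x

theorem connectedMarkedCount_zero (N : ℕ) [NeZero N] :
    connectedMarkedCount 0 N = if N = 1 then 1 else 0 := by
  have hrange : Set.range (Sum.inr : Fin N → Fin 0 ⊕ Fin N) = Set.univ :=
    Set.range_eq_univ.2 (Equiv.emptySum _ _).symm.surjective
  have hmarked (p : PermPair (Fin 0 ⊕ Fin N)) : p.IsMarked Set.univ ↔ p = 1 := by
    rw [PermPair.IsMarked, separatesCycles_univ_iff, Prod.ext_iff]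
    exact and_congr_left' ⟨fun h => Perm.ext fun x => (h.2 x).2 trivial,
      fun h => by simp [h, IsMatchingOff, Function.Involutive]⟩
  have hconn : IsConnected (1 : PermPair (Fin 0 ⊕ Fin N)) ↔ N = 1 := by
    rw [isConnected_one_iff, ← Finite.card_le_one_iff_subsingleton, Nat.card_sum, Nat.card_fin,
      Nat.card_fin, zero_add]
    exact (Nat.one_le_iff_ne_zero.2 (NeZero.ne N)).ge_iff_eq'
  rw [connectedMarkedCount, hrange]
  simp only [hmarked]
  split_ifs with h
  · have : Unique {p : PermPair (Fin 0 ⊕ Fin N) // p = 1 ∧ p.IsConnected} :=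
      ⟨⟨⟨1, rfl, hconn.2 h⟩⟩, fun p => Subtype.ext p.2.1⟩
    exact Nat.card_unique
  · exact Nat.card_eq_zero.2 (.inl ⟨fun p => h (hconn.1 (p.2.1 ▸ p.2.2))⟩)

theorem connectedMarkedCount_eq (n N : ℕ) [NeZero N] :
    connectedMarkedCount n N = if Even n then n.factorial * numRooted N (n / 2) else 0 := by
  split_ifs with hn
  · obtain ⟨e, rfl⟩ := hn.exists_two_nsmul
    rw [smul_eq_mul, Nat.mul_div_cancel_left _ two_pos, numRooted]
    split_ifs with he hN
    · simp [he, hN, connectedMarkedCount_zero]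
    · simp [he, hN, connectedMarkedCount_zero]
    · have : NeZero e := ⟨he⟩
      rw [← NRootedGraph.card_eq_connectedMarkedCount,
        NRootedGraph.card_eq_card_quotient_mul_factorial, mul_comm]
  · have hzero : markedCount n N = 0 := by
      simpa [hn, N.factorial_ne_zero] using markedCount_mul_factorial n N
    exact Nat.eq_zero_of_le_zero (hzero ▸ Nat.card_mono (Set.toFinite _) fun _ => And.left)

end PermPair

end PermutationPairs

section Logarithm

open PowerSeries

variable {R : Type*} [CommRing R]

theorem mem_weightTuples {N : ℕ} {a : Fin N → ℕ} :
    a ∈ weightTuples N ↔ ∑ j : Fin N, ((j : ℕ) + 1) * a j = N := by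
  simp only [weightTuples, Finset.mem_filter, Fintype.mem_piFinset, Finset.mem_range,
    and_iff_right_iff_imp]
  intro h j
  calc a j ≤ ((j : ℕ) + 1) * a j := Nat.le_mul_of_pos_left _ (Nat.succ_pos _)
    _ ≤ ∑ j : Fin N, ((j : ℕ) + 1) * a j :=
      Finset.single_le_sum_of_canonicallyOrdered (f := fun j : Fin N => ((j : ℕ) + 1) * a j)
        (Finset.mem_univ j)
    _ < N + 1 := by omega

theorem sum_le_of_mem_weightTuples {N : ℕ} {a : Fin N → ℕ} (ha : a ∈ weightTuples N) :
    ∑ j, a j ≤ N := by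
  conv_rhs => rw [← mem_weightTuples.1 ha]
  exact Finset.sum_le_sum fun j _ => Nat.le_mul_of_pos_left _ (Nat.succ_pos _)

theorem sum_ne_zero_of_mem_weightTuples {N : ℕ} [NeZero N] {a : Fin N → ℕ}
    (ha : a ∈ weightTuples N) : ∑ j, a j ≠ 0 := by
  refine fun h => NeZero.ne N ?_
  rw [← mem_weightTuples.1 ha, Finset.sum_eq_zero_iff]
  exact fun j hj => by rw [Finset.sum_eq_zero_iff.1 h j hj, mul_zero]

theorem coe_trunc_succ_eq_sum_monomial {f : R⟦X⟧} (hf : constantCoeff f = 0) (N : ℕ) :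
    (trunc (N + 1) f : R⟦X⟧) =
      ∑ j : Fin N, monomial ((j : ℕ) + 1) (coeff ((j : ℕ) + 1) f) := by
  rw [trunc_apply, Nat.Ico_zero_eq_range, Finset.sum_range_succ', coeff_zero_eq_constantCoeff, hf,
    map_zero, add_zero, ← Polynomial.coeToPowerSeries.ringHom_apply, map_sum, Finset.sum_range]
  simp

theorem coeff_pow_eq_sum_weightTuples {f : R⟦X⟧} (hf : constantCoeff f = 0) (N m : ℕ) :
    coeff N (f ^ m) = ∑ k ∈ (weightTuples N).filter fun k => ∑ j, k j = m,
      (Nat.multinomial Finset.univ k : R) * ∏ j : Fin N, coeff ((j : ℕ) + 1) f ^ k j := by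
  have hset : (weightTuples N).filter (fun k => ∑ j, k j = m) =
      (Finset.univ.piAntidiag m).filter fun k => ∑ j : Fin N, ((j : ℕ) + 1) * k j = N := by
    ext k
    simp [mem_weightTuples, and_comm]
  rw [hset, ← coeff_coe_trunc_of_lt N.lt_succ_self, ← trunc_trunc_pow,
    coeff_coe_trunc_of_lt N.lt_succ_self, coe_trunc_succ_eq_sum_monomial hf,
    Finset.sum_pow_eq_sum_piAntidiag, map_sum, Finset.sum_filter]
  refine Finset.sum_congr rfl fun k _ => ?_
  simp only [monomial_pow]
  rw [prod_monomial, ← map_natCast (C (R := R)), coeff_C_mul, coeff_monomial]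
  simp only [mul_comm (k _), eq_comm (a := N), mul_ite, mul_zero]

theorem coeff_subst_eq_sum_range {b : R⟦X⟧} (hb : constantCoeff b = 0) (f : R⟦X⟧) (N : ℕ) :
    coeff N (f.subst b) = ∑ m ∈ Finset.range (N + 1), coeff m f * coeff N (b ^ m) := by
  rw [coeff_subst' (.of_constantCoeff_zero' hb)]
  refine finsum_eq_sum_of_support_subset _ fun m hm => ?_
  by_contra hmN
  have hdvd : X ^ m ∣ b ^ m := pow_dvd_pow_of_dvd (X_dvd_iff.2 hb) m
  refine hm ?_
  dsimp only
  rw [X_pow_dvd_iff.1 hdvd N (by simpa using hmN), smul_zero]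

theorem derivative_mul_C (f : R⟦X⟧) (c : R) : d⁄dX R (f * C c) = d⁄dX R f * C c := by
  rw [Derivation.leibniz, derivative_C, smul_zero, zero_add, smul_eq_mul, mul_comm]

variable [Algebra ℚ R]

theorem mul_derivative_logOf {f : R⟦X⟧} (hf : constantCoeff f = 1) :
    f * d⁄dX R (logOf f) = d⁄dX R f := by
  have hsubst : HasSubst (f - 1) := .of_constantCoeff_zero' (by simp [hf])
  have hlog : (1 + X) * d⁄dX R (log R) = 1 := by
    ext n
    rcases n with _ | n
    · simp [deriv_log]
    · simp [deriv_log, add_mul, coeff_succ_X_mul, pow_succ, coeff_one]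
  have hinv : f * (d⁄dX R (log R)).subst (f - 1) = 1 := by
    have h := congrArg (substAlgHom hsubst) hlog
    rw [map_mul, map_add, map_one, substAlgHom_X, add_sub_cancel] at h
    rwa [coe_substAlgHom] at h
  rw [logOf_eq, derivative_subst hsubst, ← mul_assoc, hinv, one_mul, map_sub,
    Derivation.map_one_eq_zero, sub_zero]

/-- The generating function `∑ₙ rₙ tⁿ / (n!)²`. It is meant for `𝒵_n`, whose coefficients exceed the
numbers of marked pairs by a factor `n!`, so that it is an exponential series in the marks. -/
noncomputable def doublyExponentialSeries (r : ℕ → R) : R⟦X⟧ :=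
  mk fun n => (1 / (n.factorial : ℚ) ^ 2) • r n

theorem constantCoeff_doublyExponentialSeries (r : ℕ → R) :
    constantCoeff (doublyExponentialSeries r) = r 0 := by
  simp [doublyExponentialSeries, ← coeff_zero_eq_constantCoeff_apply]

theorem doublyExponentialSeries_mul_right (r : ℕ → R) (c : R) :
    doublyExponentialSeries (fun n => r n * c) = doublyExponentialSeries r * C c := by
  ext n
  simp [doublyExponentialSeries]

theorem multinomial_div_sum {ι : Type*} (s : Finset ι) (a : ι → ℕ) (h : ∑ i ∈ s, a i ≠ 0) :
    (Nat.multinomial s a : ℚ) / (∑ i ∈ s, a i : ℕ) =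
      ((∑ i ∈ s, a i) - 1).factorial / ∏ i ∈ s, ((a i).factorial : ℚ) := by
  have hprod : (∏ i ∈ s, ((a i).factorial : ℚ)) ≠ 0 :=
    Finset.prod_ne_zero_iff.2 fun i _ => Nat.cast_ne_zero.2 (Nat.factorial_ne_zero _)
  rw [div_eq_div_iff (Nat.cast_ne_zero.2 h) hprod, mul_comm, mul_comm (Nat.cast _)]
  exact_mod_cast (Nat.multinomial_spec s a).trans (Nat.mul_factorial_pred h).symm

theorem connectedSum_eq_coeff_logOf {r : ℕ → R} (h0 : r 0 = 1) (N : ℕ) [NeZero N] :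
    connectedSum N r =
      (N.factorial : ℚ) • coeff N (logOf (doublyExponentialSeries r)) := by
  have hconst : constantCoeff (doublyExponentialSeries r - 1) = 0 := by
    simp [constantCoeff_doublyExponentialSeries, h0]
  have hcoeff (j : ℕ) : coeff (j + 1) (doublyExponentialSeries r - 1) =
      algebraMap ℚ R (1 / ((j + 1).factorial : ℚ) ^ 2) * r (j + 1) := by
    simp [doublyExponentialSeries, coeff_one, Algebra.smul_def]
  rw [connectedSum, logOf_eq, coeff_subst_eq_sum_range hconst, ← Finset.sum_fiberwise_of_maps_to
    (g := fun a : Fin N → ℕ => ∑ j, a j) fun a ha => Finset.mem_range_succ_iff.2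
      (sum_le_of_mem_weightTuples ha), Finset.smul_sum]
  refine Finset.sum_congr rfl fun m _ => ?_
  rw [coeff_pow_eq_sum_weightTuples hconst, Finset.mul_sum, Finset.smul_sum]
  refine Finset.sum_congr rfl fun a ha => ?_
  obtain ⟨hN, rfl⟩ := Finset.mem_filter.1 ha
  have hm := sum_ne_zero_of_mem_weightTuples hN
  have hscalar : (N.factorial : ℚ) / (∏ j, ((a j).factorial : ℚ)) *
      ((-1) ^ ((∑ j, a j) - 1) * (((∑ j, a j) - 1).factorial : ℚ)) =
        N.factorial * ((-1) ^ ((∑ j, a j) + 1) / (∑ j, a j : ℕ) *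
          (Nat.multinomial Finset.univ a : ℚ)) := by
    rw [div_mul_eq_mul_div (_ ^ _), mul_div_assoc, multinomial_div_sum _ _ hm]
    obtain ⟨m, hm⟩ := Nat.exists_eq_add_one_of_ne_zero hm
    rw [hm, Nat.add_sub_cancel]
    ring
  simp only [hcoeff]
  rw [hscalar, coeff_log, if_neg hm, Algebra.smul_def, map_mul, map_mul,
    map_natCast _ (Nat.multinomial _ _), mul_assoc, mul_assoc]

theorem eq_connectedSum_of_mul_eq_derivative {r M : ℕ → R} (h0 : r 0 = 1)
    (h : doublyExponentialSeries r * mk (fun n => (1 / (n.factorial : ℚ)) • M (n + 1)) =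
      d⁄dX R (doublyExponentialSeries r)) (N : ℕ) [NeZero N] :
    M N = connectedSum N r := by
  have hconst : constantCoeff (doublyExponentialSeries r) = 1 :=
    (constantCoeff_doublyExponentialSeries r).trans h0
  have hlog : mk (fun n => (1 / (n.factorial : ℚ)) • M (n + 1)) =
      d⁄dX R (logOf (doublyExponentialSeries r)) := by
    refine (isUnit_iff_constantCoeff.2 (hconst ▸ isUnit_one)).mul_left_cancel ?_
    rw [h, mul_derivative_logOf hconst]
  obtain ⟨n, rfl⟩ := Nat.exists_eq_add_one_of_ne_zero (NeZero.ne N)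
  have hcoeff := congrArg (coeff n) hlog
  rw [coeff_mk, coeff_derivative, ← Nat.cast_succ, mul_comm, ← nsmul_eq_mul] at hcoeff
  have hfac : (n.factorial : ℚ) ≠ 0 := Nat.cast_ne_zero.2 n.factorial_ne_zero
  rw [connectedSum_eq_coeff_logOf h0, Nat.factorial_succ, mul_comm, Nat.cast_mul, mul_smul,
    Nat.cast_smul_eq_nsmul ℚ (n + 1), ← hcoeff, smul_smul, mul_one_div_cancel hfac, one_smul]

end Logarithm

section ConnectedSum

variable {R : Type*} [CommRing R] [Algebra ℚ R]

theorem map_connectedSum {S : Type*} [CommRing S] [Algebra ℚ S] (f : R →+* S) (N : ℕ)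
    (r : ℕ → R) : f (connectedSum N r) = connectedSum N fun j => f (r j) := by
  simp only [connectedSum, map_sum, map_mul, map_prod, map_pow, RingHom.map_rat_algebraMap]

theorem single_mem_weightTuples (N : ℕ) [NeZero N] : Pi.single 0 N ∈ weightTuples N := by
  rw [mem_weightTuples, Finset.sum_eq_single 0 (fun j _ hj => by simp [hj]) (by simp)]
  simp

theorem eq_single_of_sum_eq {N : ℕ} [NeZero N] {a : Fin N → ℕ} (ha : a ∈ weightTuples N)
    (hsum : ∑ j, a j = N) : a = Pi.single 0 N := by
  have hweight := mem_weightTuples.1 ha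
  simp only [add_mul, one_mul, Finset.sum_add_distrib, hsum, Nat.add_eq_right,
    Finset.sum_eq_zero_iff, Nat.mul_eq_zero] at hweight
  have hzero (j : Fin N) (hj : j ≠ 0) : a j = 0 :=
    (hweight j (Finset.mem_univ j)).resolve_left (Fin.val_ne_zero_iff.2 hj)
  rw [Finset.sum_eq_single 0 (fun j _ hj => hzero j hj) (by simp)] at hsum
  funext j
  by_cases hj : j = 0
  · rw [hj, hsum, Pi.single_eq_same]
  · rw [hzero j hj, Pi.single_eq_of_ne hj]

theorem natDegree_algebraMap_mul_prod_le {ι : Type*} (s : Finset ι) (a : ι → ℕ) (c : ℚ)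
    (d : ι → ℚ) {P : ι → Polynomial R} (hP : ∀ i, (P i).natDegree ≤ 1) :
    (algebraMap ℚ (Polynomial R) c *
      ∏ i ∈ s, (algebraMap ℚ (Polynomial R) (d i) * P i) ^ a i).natDegree ≤ ∑ i ∈ s, a i := by
  have hscale (q : ℚ) (p : Polynomial R) :
      (algebraMap ℚ (Polynomial R) q * p).natDegree ≤ p.natDegree := by
    rw [Polynomial.algebraMap_apply]
    exact Polynomial.natDegree_C_mul_le _ _
  refine (hscale _ _).trans ((Polynomial.natDegree_prod_le _ _).trans
    (Finset.sum_le_sum fun i _ => Polynomial.natDegree_pow_le.trans ?_))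
  exact (Nat.mul_le_mul_left _ ((hscale _ _).trans (hP i))).trans (mul_one _).le

theorem coeff_connectedSum {P : ℕ → Polynomial R} (h1 : P 1 = Polynomial.X)
    (hP : ∀ j, (P j).natDegree ≤ 1) (N : ℕ) [NeZero N] :
    (connectedSum N P).coeff N = algebraMap ℚ R ((-1) ^ (N - 1) * (N - 1).factorial) := by
  rw [connectedSum, Polynomial.finsetSum_coeff, Finset.sum_eq_single_of_mem _
    (single_mem_weightTuples N)]
  · have hprod : ∏ j : Fin N, (algebraMap ℚ (Polynomial R)
        (1 / (((j : ℕ) + 1).factorial : ℚ) ^ 2) * P ((j : ℕ) + 1)) ^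
          (Pi.single 0 N : Fin N → ℕ) j = Polynomial.X ^ N := by
      rw [Finset.prod_eq_single 0 (fun j _ hj => by rw [Pi.single_eq_of_ne hj, pow_zero]) (by simp)]
      simp [h1]
    have hfac : ∏ j, (((Pi.single 0 N : Fin N → ℕ) j).factorial : ℚ) = N.factorial := by
      rw [Finset.prod_eq_single 0 (fun j _ hj => by simp [hj]) (by simp), Pi.single_eq_same]
    rw [hprod, hfac, div_self (Nat.cast_ne_zero.2 N.factorial_ne_zero), one_mul,
      Polynomial.algebraMap_apply, Polynomial.coeff_C_mul, Polynomial.coeff_X_pow_self, mul_one]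
    simp
  · exact fun a ha hne => Polynomial.coeff_eq_zero_of_natDegree_lt
      ((natDegree_algebraMap_mul_prod_le _ _ _ _ fun j => hP _).trans_lt
        ((sum_le_of_mem_weightTuples ha).lt_of_ne fun hsum => hne (eq_single_of_sum_eq ha hsum)))

theorem degree_connectedSum [Nontrivial R] {P : ℕ → Polynomial R} (h1 : P 1 = Polynomial.X)
    (hP : ∀ j, (P j).natDegree ≤ 1) (N : ℕ) [NeZero N] : (connectedSum N P).degree = N := by
  refine Polynomial.degree_eq_of_le_of_coeff_ne_zero (Polynomial.degree_le_of_natDegree_le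
    (Polynomial.natDegree_sum_le_of_forall_le _ _ fun a ha => ?_)) ?_
  · exact (natDegree_algebraMap_mul_prod_le _ _ _ _ fun j => hP _).trans
      (sum_le_of_mem_weightTuples ha)
  · rw [coeff_connectedSum h1 hP, Ne, map_eq_zero_iff _ (algebraMap ℚ R).injective]
    simp [Nat.factorial_ne_zero]

end ConnectedSum

section GeneratingFunctions

open PowerSeries PermPair

theorem coeff_serZ (n j : ℕ) :
    coeff n (serZ j) = (markedCount n j : ℚ) * j.factorial / n.factorial := by
  have h : (markedCount n j : ℚ) * j.factorial =
      (if Even n then ((n - 1).doubleFactorial : ℚ) else 0) * (n + j).factorial := by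
    exact_mod_cast markedCount_mul_factorial n j
  rw [h, serZ, coeff_mk, ite_mul, zero_mul, ite_div, zero_div, mul_comm]

theorem coeff_genM (n N : ℕ) [NeZero N] :
    coeff n (genM N) = (connectedMarkedCount n N : ℚ) / n.factorial := by
  rw [connectedMarkedCount_eq, genM, coeff_mk]
  split_ifs
  · rw [Nat.cast_mul, mul_div_cancel_left₀ _ (Nat.cast_ne_zero.2 n.factorial_ne_zero)]
  · simp

/-- The component of a mark has `i` further marks and carries a factor `M_{i+1}`; the rest carries
a factor `𝒵_{N-i}`. -/
theorem serZ_succ (N : ℕ) :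
    (1 / ((N + 1).factorial : ℚ)) • serZ (N + 1) = ∑ i ∈ Finset.range (N + 1),
      ((N.choose i : ℚ) / ((N - i).factorial : ℚ)) • (genM (i + 1) * serZ (N - i)) := by
  ext n
  rw [map_sum, coeff_smul, coeff_serZ, markedCount_succ]
  push_cast
  rw [mul_div_assoc, Finset.sum_mul, Finset.smul_sum]
  refine Finset.sum_congr rfl fun i _ => ?_
  rw [coeff_smul, coeff_mul, Finset.Nat.sum_antidiagonal_eq_sum_range_succ_mk]
  simp only [smul_eq_mul, Finset.mul_sum, Finset.sum_mul]
  refine Finset.sum_congr rfl fun a ha => ?_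
  rw [coeff_genM, coeff_serZ, Nat.cast_choose ℚ (Finset.mem_range_succ_iff.1 ha)]
  have hN : ((N + 1).factorial : ℚ) ≠ 0 := by positivity
  field_simp

theorem serZ_one : serZ 1 = genM 1 * serZ 0 := by
  simpa using serZ_succ 0

theorem doublyExponentialSeries_serZ_mul :
    doublyExponentialSeries serZ * mk (fun n => (1 / (n.factorial : ℚ)) • genM (n + 1)) =
      d⁄dX ℚ⟦X⟧ (doublyExponentialSeries serZ) := by
  ext1 N
  have hfac : ((N + 1 : ℕ) : ℚ) * (1 / ((N + 1).factorial : ℚ) ^ 2) =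
      1 / (N.factorial : ℚ) * (1 / ((N + 1).factorial : ℚ)) := by
    rw [Nat.factorial_succ]
    push_cast
    field_simp
  rw [mul_comm, coeff_mul, Finset.Nat.sum_antidiagonal_eq_sum_range_succ_mk, coeff_derivative,
    ← Nat.cast_succ, mul_comm (coeff _ _), ← nsmul_eq_mul, ← Nat.cast_smul_eq_nsmul ℚ]
  simp only [doublyExponentialSeries, coeff_mk]
  rw [smul_smul, hfac, mul_smul, serZ_succ, Finset.smul_sum]
  refine Finset.sum_congr rfl fun i hi => ?_
  rw [smul_mul_smul_comm, smul_smul, Nat.cast_choose ℚ (Finset.mem_range_succ_iff.1 hi)]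
  congr 1
  field_simp

theorem constantCoeff_serZ_zero : constantCoeff (serZ 0) = 1 := by
  simp [serZ, ← coeff_zero_eq_constantCoeff_apply]

theorem genM_eq_connectedSum (N : ℕ) [NeZero N] :
    genM N = connectedSum N fun j => serZ j * (serZ 0)⁻¹ := by
  have hinv : serZ 0 * (serZ 0)⁻¹ = 1 :=
    PowerSeries.mul_inv_cancel _ (by rw [constantCoeff_serZ_zero]; exact one_ne_zero)
  refine eq_connectedSum_of_mul_eq_derivative hinv ?_ N
  rw [doublyExponentialSeries_mul_right, mul_right_comm, doublyExponentialSeries_serZ_mul,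
    derivative_mul_C]

end GeneratingFunctions

section ShiftedSeries

open PowerSeries

theorem sum_coeffB_succ_mul {R : Type*} [CommRing R] (n : ℕ) (f : ℕ → R) :
    ∑ k ∈ Finset.range (n + 2), (coeffB (n + 1) k : R) * f k =
      ∑ k ∈ Finset.range (n + 1), (coeffB n k : R) * (f (k + 1) + (2 * k + n + 1) * f k) := by
  have hshift : ∑ k ∈ Finset.range (n + 1),
        (2 * ((k + 1 : ℕ) : R) + n + 1) * coeffB n (k + 1) * f (k + 1) +
        (2 * ((0 : ℕ) : R) + n + 1) * coeffB n 0 * f 0 =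
      ∑ k ∈ Finset.range (n + 1), (2 * (k : R) + n + 1) * coeffB n k * f k := by
    rw [← Finset.sum_range_succ' fun k : ℕ => (2 * (k : R) + n + 1) * coeffB n k * f k,
      Finset.sum_range_succ, coeffB_eq_zero n (n + 1) n.lt_succ_self]
    simp
  simp only [mul_add (coeffB n _ : R), Finset.sum_add_distrib, mul_left_comm (coeffB n _ : R)]
  simp only [← mul_assoc, ← hshift]
  rw [← add_assoc, ← Finset.sum_add_distrib, Finset.sum_range_succ']
  congr 1
  · refine Finset.sum_congr rfl fun k _ => ?_
    rw [coeffB]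
    push_cast
    ring
  · rw [coeffB]
    push_cast
    ring

theorem sum_neg_one_pow_mul_coeffB_mul {R : Type*} [CommRing R] {x : R} {D : ℕ → R}
    (hD : ∀ k : ℕ, D (k + 1) = (x + 2 * k + 1) * D k) (n : ℕ) :
    ∑ k ∈ Finset.range (n + 1), (coeffB n k : R) * ((-1) ^ (n - k) * D k) =
      (descPochhammer R n).eval x * D 0 := by
  induction n with
  | zero => simp [coeffB]
  | succ n ih =>
    rw [sum_coeffB_succ_mul, descPochhammer_succ_eval, mul_right_comm, ← ih, Finset.sum_mul]
    refine Finset.sum_congr rfl fun k hk => ?_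
    rw [Nat.add_sub_add_right, Nat.succ_sub (Finset.mem_range_succ_iff.1 hk),
      Nat.succ_eq_add_one, pow_succ, hD]
    ring

theorem sum_choose_mul_descFactorial (i j : ℕ) :
    ∑ n ∈ Finset.range (j + 1), (j.choose n : ℚ) * ((j.factorial : ℚ) / (n.factorial : ℚ)) *
        (i.descFactorial n : ℚ) = ((i + j).factorial : ℚ) / i.factorial := by
  have hvandermonde : ((i + j).choose j : ℚ) =
      ∑ n ∈ Finset.range (j + 1), (i.choose n : ℚ) * (j.choose n : ℚ) := by
    rw [Nat.add_choose_eq, Finset.Nat.sum_antidiagonal_eq_sum_range_succ_mk, Nat.cast_sum]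
    refine Finset.sum_congr rfl fun n hn => ?_
    rw [Nat.choose_symm (Finset.mem_range_succ_iff.1 hn), Nat.cast_mul]
  have hchoose : ((i + j).factorial : ℚ) / i.factorial = j.factorial * (i + j).choose j := by
    rw [Nat.cast_choose ℚ (Nat.le_add_left j i), Nat.add_sub_cancel]
    field_simp
  rw [hchoose, hvandermonde, Finset.mul_sum]
  refine Finset.sum_congr rfl fun n _ => ?_
  rw [Nat.descFactorial_eq_factorial_mul_choose, Nat.cast_mul]
  field_simp

/-- The series `∑ₘ (2m+2k-1)!! λ^{2m}`, of which every `𝒵_j` is a linear combination. -/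
noncomputable def shiftedSeries (k : ℕ) : ℚ⟦X⟧ :=
  mk fun i => if Even i then ((i + 2 * k - 1).doubleFactorial : ℚ) else 0

theorem shiftedSeries_eq_add (k : ℕ) :
    shiftedSeries k = C ((2 * k - 1).doubleFactorial : ℚ) + X ^ 2 * shiftedSeries (k + 1) := by
  ext i
  rw [map_add, coeff_X_pow_mul', coeff_C, shiftedSeries, coeff_mk, shiftedSeries, coeff_mk]
  rcases i with _ | _ | i
  · simp
  · simp
  · simp [Nat.even_add_one, show i + 1 + 1 + 2 * k = i + 2 * (k + 1) by ring]

/-- Expand `(i+j)!/i!` into falling factorials of `i` (Vandermonde), and these into the products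
`(i+2k-1)!!/(i-1)!!`. -/
theorem serZ_eq_sum_shiftedSeries (j : ℕ) :
    serZ j = ∑ n ∈ Finset.range (j + 1), ∑ k ∈ Finset.range (n + 1),
      C ((j.choose n : ℚ) * ((j.factorial : ℚ) / (n.factorial : ℚ)) *
        ((-1) ^ (n - k) * (coeffB n k : ℚ))) * shiftedSeries k := by
  ext i
  simp only [map_sum, coeff_C_mul, serZ, shiftedSeries, coeff_mk]
  split_ifs
  · have hstep (k : ℕ) : ((i + 2 * (k + 1) - 1).doubleFactorial : ℚ) =
        (i + 2 * k + 1) * (i + 2 * k - 1).doubleFactorial := by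
      rw [show i + 2 * (k + 1) - 1 = i + 2 * k + 1 by omega, Nat.doubleFactorial_add_one]
      push_cast
      rfl
    rw [mul_div_right_comm, ← sum_choose_mul_descFactorial, Finset.sum_mul]
    refine Finset.sum_congr rfl fun n _ => ?_
    have hsum := sum_neg_one_pow_mul_coeffB_mul
      (D := fun k => ((i + 2 * k - 1).doubleFactorial : ℚ)) hstep n
    simp only [descPochhammer_eval_eq_descFactorial, mul_zero, add_zero] at hsum
    rw [mul_assoc, ← hsum, Finset.mul_sum]
    exact Finset.sum_congr rfl fun k _ => by ring
  · simp

theorem shiftedSeries_zero : shiftedSeries 0 = serZ 0 := by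
  simp [serZ_eq_sum_shiftedSeries 0, coeffB]

theorem shiftedSeries_one : shiftedSeries 1 = serZ 1 := by
  simp [serZ_eq_sum_shiftedSeries 1, coeffB, Finset.sum_range_succ]

theorem serZ_zero_mul_one_sub : serZ 0 * (1 - X ^ 2 * genM 1) = 1 := by
  have h := shiftedSeries_eq_add 0
  rw [shiftedSeries_zero, zero_add, shiftedSeries_one, serZ_one,
    show (2 * 0 - 1 : ℕ).doubleFactorial = 1 from rfl, Nat.cast_one, map_one] at h
  linear_combination h

end ShiftedSeries

section Evaluation

/-- The bracket in the definition of `P_j`, as a polynomial in `X`: it represents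
`(∑ₘ (2m+2k-1)!! λ^{2m}) / 𝒵_0`. -/
noncomputable def shiftedRatioPoly (k : ℕ) : Polynomial (LaurentPolynomial ℚ) :=
  (if k = 0 then 1 else 0)
    + (if 1 ≤ k then
        Polynomial.C (LaurentPolynomial.T (-(2 * (k : ℤ) - 2))) * Polynomial.X
      else 0)
    - (if 2 ≤ k then
        (1 - Polynomial.C (LaurentPolynomial.T 2) * Polynomial.X) *
          ∑ m ∈ Finset.range (k - 1),
            Polynomial.C (LaurentPolynomial.C ((2 * m + 1).doubleFactorial : ℚ) *
              LaurentPolynomial.T (-(2 * (k : ℤ) - 2 * (m : ℤ) - 2)))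
      else 0)

theorem ratioPoly_eq_sum_shiftedRatioPoly (j : ℕ) :
    ratioPoly j = ∑ n ∈ Finset.range (j + 1), ∑ k ∈ Finset.range (n + 1),
      Polynomial.C (LaurentPolynomial.C
        ((j.choose n : ℚ) * ((j.factorial : ℚ) / (n.factorial : ℚ)) *
          ((-1) ^ (n - k) * (coeffB n k : ℚ)))) * shiftedRatioPoly k :=
  rfl

theorem shiftedRatioPoly_zero : shiftedRatioPoly 0 = 1 := by
  simp [shiftedRatioPoly]

theorem shiftedRatioPoly_succ (s : ℕ) :
    shiftedRatioPoly (s + 1) =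
      Polynomial.C (LaurentPolynomial.T (-(2 * s : ℤ))) * Polynomial.X -
        (1 - Polynomial.C (LaurentPolynomial.T 2) * Polynomial.X) *
          ∑ m ∈ Finset.range s, Polynomial.C (LaurentPolynomial.C
            ((2 * m + 1).doubleFactorial : ℚ) * LaurentPolynomial.T (-(2 * s - 2 * m : ℤ))) := by
  have hexp (m : ℤ) : -(2 * ((s + 1 : ℕ) : ℤ) - m - 2) = -(2 * s - m) := by
    push_cast
    ring
  have hexp_zero := hexp 0
  rw [sub_zero, sub_zero] at hexp_zero
  rw [shiftedRatioPoly, if_neg s.succ_ne_zero, if_pos (Nat.le_add_left 1 s), zero_add, hexp_zero]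
  simp only [hexp, Nat.add_sub_cancel]
  rcases s with _ | s
  · simp
  · rw [if_pos (by omega)]

theorem shiftedRatioPoly_eq_add (k : ℕ) :
    shiftedRatioPoly k =
      Polynomial.C (LaurentPolynomial.C ((2 * k - 1).doubleFactorial : ℚ)) *
          (1 - Polynomial.C (LaurentPolynomial.T 2) * Polynomial.X) +
        Polynomial.C (LaurentPolynomial.T 2) * shiftedRatioPoly (k + 1) := by
  rcases k with _ | s
  · simp [shiftedRatioPoly_zero, shiftedRatioPoly_succ]
  · have hT (i : ℤ) : Polynomial.C (LaurentPolynomial.T (R := ℚ) (-(2 * s - i))) =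
        Polynomial.C (LaurentPolynomial.T 2) *
          Polynomial.C (LaurentPolynomial.T (-(2 * (s + 1 : ℕ) - i))) := by
      rw [← Polynomial.C_mul, ← LaurentPolynomial.T_add]
      congr 2
      push_cast
      ring
    have hlead := hT 0
    have hlast := hT (2 * s)
    rw [sub_zero, sub_zero] at hlead
    rw [sub_self, neg_zero, LaurentPolynomial.T_zero, Polynomial.C_1] at hlast
    rw [shiftedRatioPoly_succ, shiftedRatioPoly_succ, Finset.sum_range_succ, hlead,
      show 2 * (s + 1) - 1 = 2 * s + 1 by omega]
    simp only [Polynomial.C_mul, hT,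
      mul_left_comm _ (Polynomial.C (LaurentPolynomial.T (R := ℚ) 2)), ← Finset.mul_sum]
    linear_combination -Polynomial.C (LaurentPolynomial.C ((2 * s + 1).doubleFactorial : ℚ)) *
      (1 - Polynomial.C (LaurentPolynomial.T 2) * Polynomial.X) * hlast

theorem natDegree_shiftedRatioPoly_le (k : ℕ) : (shiftedRatioPoly k).natDegree ≤ 1 := by
  have hX (c : LaurentPolynomial ℚ) : (Polynomial.C c * Polynomial.X).natDegree ≤ 1 :=
    (Polynomial.natDegree_C_mul_le _ _).trans Polynomial.natDegree_X_le
  rcases k with _ | s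
  · simp [shiftedRatioPoly_zero]
  · rw [shiftedRatioPoly_succ, ← map_sum, mul_comm (1 - _)]
    exact (Polynomial.natDegree_sub_le _ _).trans (max_le (hX _)
      ((Polynomial.natDegree_C_mul_le _ _).trans
        ((Polynomial.natDegree_sub_le _ _).trans (max_le (by simp) (hX _)))))

theorem natDegree_ratioPoly_le (j : ℕ) : (ratioPoly j).natDegree ≤ 1 := by
  rw [ratioPoly_eq_sum_shiftedRatioPoly]
  exact Polynomial.natDegree_sum_le_of_forall_le _ _ fun n _ =>
    Polynomial.natDegree_sum_le_of_forall_le _ _ fun k _ =>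
      (Polynomial.natDegree_C_mul_le _ _).trans (natDegree_shiftedRatioPoly_le k)

theorem ratioPoly_one : ratioPoly 1 = Polynomial.X := by
  simp [ratioPoly, Finset.sum_range_succ, coeffB]

theorem toSeries_T (n : ℕ) :
    toSeries (LaurentPolynomial.T n) = ((PowerSeries.X ^ n : PowerSeries ℚ) : ℚ⸨X⸩) := by
  rw [toSeries, LaurentPolynomial.eval₂_T, Units.val_zpow_eq_zpow_val, map_pow,
    PowerSeries.coe_X, zpow_natCast, lamUnit, Units.val_mk0]

theorem toSeries_C (q : ℚ) :
    toSeries (LaurentPolynomial.C q) = ((PowerSeries.C q : PowerSeries ℚ) : ℚ⸨X⸩) := by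
  rw [toSeries, LaurentPolynomial.eval₂_C, PowerSeries.coe_C]

/-- `evalAtM1` as a ring homomorphism. -/
noncomputable def evalAtM1Hom : Polynomial (LaurentPolynomial ℚ) →+* ℚ⸨X⸩ :=
  Polynomial.eval₂RingHom toSeries (genM 1 : ℚ⸨X⸩)

theorem evalAtM1Hom_apply (P : Polynomial (LaurentPolynomial ℚ)) :
    evalAtM1Hom P = evalAtM1 P :=
  rfl

theorem evalAtM1Hom_C (c : LaurentPolynomial ℚ) :
    evalAtM1Hom (Polynomial.C c) = toSeries c :=
  Polynomial.eval₂_C _ _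

theorem evalAtM1Hom_X : evalAtM1Hom Polynomial.X = (genM 1 : ℚ⸨X⸩) :=
  Polynomial.eval₂_X _ _

theorem coe_serZ_zero_mul_one_sub :
    (serZ 0 : ℚ⸨X⸩) * (1 - ((PowerSeries.X ^ 2 * genM 1 : PowerSeries ℚ) : ℚ⸨X⸩)) = 1 := by
  rw [← map_one (HahnSeries.ofPowerSeries ℤ ℚ), ← map_sub, ← map_mul, serZ_zero_mul_one_sub]

theorem evalAtM1Hom_shiftedRatioPoly_mul (k : ℕ) :
    evalAtM1Hom (shiftedRatioPoly k) * (serZ 0 : ℚ⸨X⸩) = (shiftedSeries k : ℚ⸨X⸩) := by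
  induction k with
  | zero => rw [shiftedRatioPoly_zero, map_one, one_mul, shiftedSeries_zero]
  | succ k ih =>
    have hT : toSeries (LaurentPolynomial.T 2) = ((PowerSeries.X ^ 2 : PowerSeries ℚ) : ℚ⸨X⸩) :=
      toSeries_T 2
    have hX : ((PowerSeries.X ^ 2 : PowerSeries ℚ) : ℚ⸨X⸩) ≠ 0 := by simp
    rw [shiftedRatioPoly_eq_add, shiftedSeries_eq_add] at ih
    simp only [map_add, map_mul, map_sub, map_one, evalAtM1Hom_C, evalAtM1Hom_X, toSeries_C,
      hT] at ih
    have hinv := coe_serZ_zero_mul_one_sub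
    rw [map_mul] at hinv
    refine mul_left_cancel₀ hX ?_
    linear_combination ih -
      ((PowerSeries.C ((2 * k - 1).doubleFactorial : ℚ) : PowerSeries ℚ) : ℚ⸨X⸩) * hinv

theorem evalAtM1Hom_ratioPoly_mul (j : ℕ) :
    evalAtM1Hom (ratioPoly j) * (serZ 0 : ℚ⸨X⸩) = (serZ j : ℚ⸨X⸩) := by
  simp only [ratioPoly_eq_sum_shiftedRatioPoly, serZ_eq_sum_shiftedSeries j, map_sum, map_mul,
    Finset.sum_mul, mul_assoc, evalAtM1Hom_shiftedRatioPoly_mul, evalAtM1Hom_C, toSeries_C]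

theorem coe_serZ_zero_ne_zero : (serZ 0 : ℚ⸨X⸩) ≠ 0 :=
  left_ne_zero_of_mul_eq_one coe_serZ_zero_mul_one_sub

theorem serZ_div_serZ_zero (j : ℕ) :
    (serZ j : ℚ⸨X⸩) / (serZ 0 : ℚ⸨X⸩) = evalAtM1 (ratioPoly j) := by
  rw [div_eq_iff coe_serZ_zero_ne_zero, ← evalAtM1Hom_apply, evalAtM1Hom_ratioPoly_mul]

theorem coe_serZ_mul_inv (j : ℕ) :
    ((serZ j * (serZ 0)⁻¹ : PowerSeries ℚ) : ℚ⸨X⸩) = (serZ j : ℚ⸨X⸩) / (serZ 0 : ℚ⸨X⸩) := by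
  rw [eq_div_iff coe_serZ_zero_ne_zero, ← map_mul, mul_assoc,
    PowerSeries.inv_mul_cancel _ (by simp [constantCoeff_serZ_zero]), mul_one]

theorem coe_genM_eq_connectedSum (N : ℕ) [NeZero N] :
    (genM N : ℚ⸨X⸩) = connectedSum N fun j => (serZ j : ℚ⸨X⸩) / (serZ 0 : ℚ⸨X⸩) := by
  rw [genM_eq_connectedSum, map_connectedSum]
  simp only [coe_serZ_mul_inv]

end Evaluation

theorem theorem3 :
    ((serZ 0 - 1 = PowerSeries.X ^ 2 * genM 1 * serZ 0) ∧
      ((serZ 0)⁻¹ = 1 - PowerSeries.X ^ 2 * genM 1)) ∧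
    (∀ j : ℕ, (serZ j : ℚ⸨X⸩) / (serZ 0 : ℚ⸨X⸩) = evalAtM1 (ratioPoly j)) ∧
    (∀ N : ℕ, 1 ≤ N →
      (genM N : ℚ⸨X⸩) = connectedSum N (fun j => (serZ j : ℚ⸨X⸩) / (serZ 0 : ℚ⸨X⸩)) ∧
      (genM N : ℚ⸨X⸩) = evalAtM1 (connectedSum N ratioPoly) ∧
      (connectedSum N ratioPoly).degree = N) := by
  refine ⟨⟨?_, ?_⟩, serZ_div_serZ_zero, fun N hN => ?_⟩
  · linear_combination serZ_zero_mul_one_sub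
  · rw [PowerSeries.inv_eq_iff_mul_eq_one (by simp [constantCoeff_serZ_zero]), mul_comm,
      serZ_zero_mul_one_sub]
  · have : NeZero N := ⟨Nat.one_le_iff_ne_zero.1 hN⟩
    refine ⟨coe_genM_eq_connectedSum N, ?_, degree_connectedSum ratioPoly_one
      natDegree_ratioPoly_le N⟩
    rw [coe_genM_eq_connectedSum, ← evalAtM1Hom_apply, map_connectedSum]
    simp only [evalAtM1Hom_apply, serZ_div_serZ_zero]
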